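/- Let $D$ be a division ring with center $F$, let $D^*$ be its multiplicative group, and let $K$ be a division subring of $D$. A subgroup $H$ of a group $\Gamma$ is called almost subnormal in $\Gamma$ if there is a finite chain of subgroups $H=H_0\le H_1\le\cdots\le H_n=\Gamma$ such that, for each $0\le i\le n-1$, either the index $[H_{i+1}:H_i]$ is finite or $H_i$ is normal in $H_{i+1}$. Let $G$ be an almost subnormal subgroup of $D^*$ that is non-central, i.e. $G\not\subseteq F$. If $g^{-1}Kg\subseteq K$ for every $g\in G$, then either $K\subseteq F$ or $K=D$. -/

import Mathlib

/-- A subgroup `H` of a group `Γ` is *almost subnormal* in `Γ` if there is a finite chain of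
subgroups `H = S 0 ≤ S 1 ≤ ⋯ ≤ S n = Γ` such that, for each `i < n`, either the index
`[S (i + 1) : S i]` is finite or `S i` is normal in `S (i + 1)`.
(The values `S i` with `i > n` play no role.) -/
def IsAlmostSubnormal {Γ : Type*} [Group Γ] (H : Subgroup Γ) : Prop :=
  ∃ (n : ℕ) (S : ℕ → Subgroup Γ), S 0 = H ∧ S n = ⊤ ∧
    ∀ i < n, S i ≤ S (i + 1) ∧
      ((S i).IsFiniteRelIndex (S (i + 1)) ∨ ((S i).subgroupOf (S (i + 1))).Normal)

/-!
Throughout, `F` is the center of `D`, and `cm a y = a y a⁻¹ y⁻¹`, `tau a y = a y a⁻¹ - y`. If `G` is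
subnormal of depth `n`, then `(cm a)^[n] y ∈ G` for all `a ∈ G`, `y ≠ 0`. The proof exploits this
for `y = 1 + v z`, where `z` normalizes an invariant division subring `V` and its powers are left
independent over `V`: modulo `z ^ 2` the iterated commutator is `1 + (tau a)^[n] (v z)`
(`FirstOrder.cm_iterate`), and since it normalizes `V`, its linear term must commute with `V`
(`commute_tau_iterate`). Hence every `a ∈ G ∩ V` acts unipotently on `V`, which forces `G ∩ V` to be
central in `V` (`commute_of_tau_nilpotent`, `commute_of_linearIndependent`). Otherwise every
normalizing `z` satisfies a relation over `V`, whose coefficients are controlled by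
`exists_mul_pow_commute`, `exists_pow_mem_spanLT_of_comm` and `isMonomial_of_conj_mem`. If `F` is
infinite, an ultrapower of `D` contains a transcendental central `z`, so that first-order expansions
in elements of `F` are available as well (`Expansion`).

For commutative `P` normalized by `a`, if the `t ∈ P` commuting with `a` are infinite in number and
the iterated commutators with all these `y + t` become trivial, then `a` commutes with `y`
(`comm_of_cm_iterate`); a conjugation of finite order with finitely many fixed points is handled by
Wedderburn's theorem (`comm_of_fixed_finite`).

The subnormal case `invariantTrivial` goes by induction on the depth, simultaneously for all
division rings, as centralizers of subsets of `D` have to be considered; depth `0` is the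
Cartan–Brauer–Hua theorem. The induction hypothesis says that noncentral `G` of the next depth has
centralizer `F` and generates `D`. From this, successively: commutative invariant division subrings
are central (`commute_of_comm`); so are invariant `K` with `G ∩ K ⊆ F` (`mem_center_of_inter`, using
`commute_of_conj_eq_mul` to descend along the chain); noncentral invariant division subrings have
centralizer `F` (`cent_le_center`, using Jacobson's theorem `comm_of_locally_finite` when `F` is
finite). Given a noncentral invariant `K ≠ D`, choose `x ∈ G \ K`. It is algebraic over `K`, so
`E = ∑ K x ^ i` is a division ring. An element of `E` that conjugates the commutators of `G ∩ K` into `K`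
is of the form `k x ^ i f` with `k ∈ K`, `f ∈ F`; such elements normalize `K`, and their commutators
lie in `K`. This lets the property of normalizing `K` climb the subnormal chain up to all of
`E \ {0}` (`normalizes_of_mem_spanLT`), and then `k x` and `1 + k x` both normalize `K`, which puts `k x`
into `F` for all `k ∈ K` and makes `K` central.

For almost subnormal `G`, each term of the chain contains a subnormal subgroup with finite index
(`exists_subnormal`). If the one inside `G` is noncentral, the subnormal case applies to it. If it
is central, `G` is finite modulo the center; this finiteness climbs the chain up to `Dˣ`
(`relIndex_center_ne_zero`), whereupon `D` is commutative (`mem_center_of_index_ne_zero`).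
-/

namespace AlmostSubnormal

/-! ### Iterated multiplicative differences in a commutative field -/

section FieldAutomorphism

open Polynomial

variable {P : Type*} [Field P]

/-- The multiplicative difference `x ↦ σ(x) / x` of a field endomorphism. -/
def mulDiff (σ : P →+* P) (x : P) : P := σ x * x⁻¹

/-- If `(σ - 1) ^ N` kills `x`, written multiplicatively, and `σ ^ r` fixes `x`, then `σ - 1`
sends `x` to a torsion element: the norm of `σ(x) / x` along the orbit is `1`. -/
lemma mulDiff_pow_eq_one (σ : P →+* P) {r : ℕ} (N : ℕ) :
    ∀ x : P, x ≠ 0 → (mulDiff σ)^[N] x = 1 → σ^[r] x = x → mulDiff σ x ^ r ^ N = 1 := by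
  induction N with
  | zero =>
    intro x _ h _
    simp only [Function.iterate_zero, id] at h
    simp [mulDiff, h]
  | succ N ih =>
    intro x hx h hr
    have hσ : ∀ y : P, y ≠ 0 → σ y ≠ 0 := fun y hy => (map_ne_zero σ).2 hy
    have hit : ∀ i : ℕ, σ^[i] x ≠ 0 := fun i => by
      induction i with
      | zero => simpa
      | succ i ih => rw [Function.iterate_succ_apply']; exact hσ _ ih
    set b := mulDiff σ x with hb
    have hb0 : b ≠ 0 := mul_ne_zero (hσ _ hx) (inv_ne_zero hx)
    have hσb : ∀ i : ℕ, σ^[i] b = σ^[i + 1] x * (σ^[i] x)⁻¹ := fun i => by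
      induction i with
      | zero => simp [hb, mulDiff]
      | succ i ih =>
        rw [Function.iterate_succ_apply', ih, map_mul, map_inv₀, ← Function.iterate_succ_apply' σ,
          ← Function.iterate_succ_apply' σ]
    have hrb : σ^[r] b = b := by
      rw [hσb, Function.iterate_succ_apply', hr, hb, mulDiff]
    have h1 := ih b hb0 (by rwa [hb, ← Function.iterate_succ_apply]) hrb
    have hfix : σ (b ^ r ^ N) = b ^ r ^ N := by
      rw [mulDiff, mul_pow, inv_pow] at h1
      rw [map_pow]
      exact (mul_inv_eq_one₀ (pow_ne_zero _ hb0)).1 h1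
    have hfix' : ∀ i : ℕ, (σ^[i] b) ^ r ^ N = b ^ r ^ N := fun i => by
      induction i with
      | zero => rfl
      | succ i ih => rw [Function.iterate_succ_apply', ← map_pow, ih, hfix]
    have hprod : ∏ i ∈ Finset.range r, σ^[i] b = 1 := by
      have : ∀ m : ℕ, ∏ i ∈ Finset.range m, σ^[i] b = σ^[m] x * x⁻¹ := fun m => by
        induction m with
        | zero => simp [hx]
        | succ m ih =>
          rw [Finset.prod_range_succ, ih, hσb]
          field_simp [hit m]
      rw [this, hr, mul_inv_cancel₀ hx]
    have := congrArg (· ^ r ^ N) hprod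
    simp only [← Finset.prod_pow, one_pow] at this
    rw [Finset.prod_congr rfl fun i _ => hfix' i, Finset.prod_const, Finset.card_range,
      ← pow_mul] at this
    rwa [pow_succ]

/-- Numerator and denominator of `(mulDiff σ)^[j] (X + y)` as polynomials in a parameter `X` fixed
by `σ`. -/
noncomputable def diffPoly (σ : P →+* P) (y : P) : ℕ → P[X] × P[X]
  | 0 => (X + C y, 1)
  | j + 1 => ((diffPoly σ y j).1.map σ * (diffPoly σ y j).2,
      (diffPoly σ y j).2.map σ * (diffPoly σ y j).1)

lemma eval_map_fixed (σ : P →+* P) {t : P} (ht : σ t = t) (p : P[X]) :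
    (p.map σ).eval t = σ (p.eval t) := by
  conv_lhs => rw [← ht]
  exact eval_map_apply σ t

lemma diffPoly_eval (σ : P →+* P) {y t : P} (ht : σ t = t) (hy : y + t ≠ 0) (j : ℕ) :
    (diffPoly σ y j).1.eval t ≠ 0 ∧ (diffPoly σ y j).2.eval t ≠ 0 ∧
      (mulDiff σ)^[j] (y + t) = (diffPoly σ y j).1.eval t / (diffPoly σ y j).2.eval t := by
  induction j with
  | zero => simp [diffPoly, add_comm t y, hy]
  | succ j ih =>
    obtain ⟨h1, h2, h3⟩ := ih
    have h1' := (map_ne_zero σ).2 h1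
    have h2' := (map_ne_zero σ).2 h2
    simp only [diffPoly, eval_mul, eval_map_fixed σ ht]
    refine ⟨mul_ne_zero h1' h2, mul_ne_zero h2' h1, ?_⟩
    rw [Function.iterate_succ_apply', h3, mulDiff, map_div₀]
    field_simp

/-- If `y` has an infinite orbit, numerator and denominator differ: the largest root `-σ ^ j (y)`
occurs in the numerator only. -/
lemma diffPoly_ne (σ : P →+* P) {y : P} (hy : ∀ i : ℕ, 1 ≤ i → σ^[i] y ≠ y) (j : ℕ) :
    (diffPoly σ y j).1 ≠ (diffPoly σ y j).2 := by
  have hsh : ∀ (p : P[X]) (m : ℕ), (p.map σ).eval (-σ^[m + 1] y) = σ (p.eval (-σ^[m] y)) := by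
    intro p m
    rw [Function.iterate_succ_apply', ← map_neg]
    exact eval_map_apply σ _
  have hA : ∀ j m : ℕ, j < m → (diffPoly σ y j).1.eval (-σ^[m] y) ≠ 0 ∧
      (diffPoly σ y j).2.eval (-σ^[m] y) ≠ 0 := by
    intro j
    induction j with
    | zero =>
      intro m hm
      refine ⟨?_, by simp [diffPoly]⟩
      simp only [diffPoly, eval_add, eval_X, eval_C]
      intro h
      exact hy m hm (neg_add_eq_zero.1 h)
    | succ j ih =>
      intro m hm
      obtain ⟨m, rfl⟩ : ∃ k, m = k + 1 := ⟨m - 1, by omega⟩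
      simp only [diffPoly, eval_mul, hsh]
      have h1 := ih m (by omega)
      have h2 := ih (m + 1) (by omega)
      exact ⟨mul_ne_zero ((map_ne_zero σ).2 h1.1) h2.2, mul_ne_zero ((map_ne_zero σ).2 h1.2) h2.1⟩
  have hB : (diffPoly σ y j).1.eval (-σ^[j] y) = 0 ∧ (diffPoly σ y j).2.eval (-σ^[j] y) ≠ 0 := by
    induction j with
    | zero => simp [diffPoly]
    | succ j ih =>
      simp only [diffPoly, eval_mul, hsh]
      refine ⟨by simp [ih.1], mul_ne_zero ((map_ne_zero σ).2 ih.2) (hA j (j + 1) (by omega)).1⟩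
  intro h
  exact hB.2 (h ▸ hB.1)

/-- A field endomorphism with infinitely many fixed elements cannot act unipotently, in the
multiplicative sense, on the translates `y + t` of an element `y` that it moves. -/
theorem fixed_of_mulDiff_iterate (σ : P →+* P) (hinf : {t | σ t = t}.Infinite) (y : P) (N : ℕ)
    (h : ∀ t, σ t = t → y + t ≠ 0 → (mulDiff σ)^[N] (y + t) = 1) : σ y = y := by
  classical
  by_contra hne
  have hinf' : ({t | σ t = t} \ {-y}).Infinite := hinf.sdiff (Set.finite_singleton _)
  have hny : ∀ t ∈ {t | σ t = t} \ {-y}, y + t ≠ 0 := by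
    rintro t ⟨_, ht⟩ h0
    exact ht (eq_neg_of_add_eq_zero_right h0)
  by_cases hper : ∃ r : ℕ, 1 ≤ r ∧ σ^[r] y = y
  · obtain ⟨r, hr, hry⟩ := hper
    have hM : 0 < r ^ N := pow_pos hr N
    refine Set.infinite_of_injOn_mapsTo (f := fun t => (σ y + t) * (y + t)⁻¹)
      (t := {x : P | x ^ r ^ N = 1}) ?_ ?_ hinf' ?_
    · intro s hs t ht hst
      have h1 := hny s hs
      have h2 := hny t ht
      simp only at hst
      field_simp at hst
      have : (σ y - y) * (s - t) = 0 := by linear_combination -hst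
      rcases mul_eq_zero.1 this with h | h
      · exact absurd (sub_eq_zero.1 h) hne
      · exact sub_eq_zero.1 h
    · intro t ht
      have h1 := mulDiff_pow_eq_one σ (r := r) N (y + t) (hny t ht) (h t ht.1 (hny t ht)) (by
        rw [iterate_map_add, hry, Function.iterate_fixed ht.1])
      simpa [mulDiff, show σ t = t from ht.1] using h1
    · refine ((nthRoots (r ^ N) (1 : P)).toFinset.finite_toSet).subset ?_
      intro x hx
      simp only [Finset.mem_coe, Multiset.mem_toFinset]
      exact (mem_nthRoots hM).2 hx
  · push Not at hper
    refine diffPoly_ne σ hper N (eq_of_infinite_eval_eq _ _ (hinf'.mono ?_))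
    intro t ht
    obtain ⟨h1, h2, h3⟩ := diffPoly_eval σ ht.1 (hny t ht) N
    rw [h t ht.1 (hny t ht)] at h3
    exact ((div_eq_one_iff_eq h2).1 h3.symm)

end FieldAutomorphism

/-! ### Division subrings, centralizers and normalizing elements -/

section Basic

variable {D : Type*} [DivisionRing D]

/-- The centralizer of a subset of a division ring, as a division subring. -/
def cent (S : Set D) : Subfield D :=
  (Subring.centralizer S).toSubfield fun x hx => by
    rw [Subring.mem_centralizer_iff] at hx ⊢
    intro g hg
    exact (show Commute g x from hx g hg).inv_right₀

lemma mem_cent {S : Set D} {x : D} : x ∈ cent S ↔ ∀ s ∈ S, s * x = x * s :=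
  Subring.mem_centralizer_iff

lemma mem_cent_cent {S : Set D} {x : D} (hx : x ∈ S) : x ∈ cent (cent S : Set D) :=
  mem_cent.2 fun _ hs => (mem_cent.1 hs x hx).symm

/-- The double centralizer of a set of commuting elements is commutative. -/
lemma cent_cent_comm {S : Set D} (hS : ∀ x ∈ S, ∀ y ∈ S, x * y = y * x) :
    ∀ x ∈ cent (cent S : Set D), ∀ y ∈ cent (cent S : Set D), x * y = y * x := by
  intro x hx y hy
  refine mem_cent.1 hy x (mem_cent.2 fun s hs => ?_)
  exact mem_cent.1 hx s (mem_cent.2 fun t ht => hS t ht s hs)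

lemma mem_center_iff {x : D} : x ∈ Subring.center D ↔ ∀ y : D, y * x = x * y :=
  Subring.mem_center_iff

lemma center_le_cent {S : Set D} {x : D} (hx : x ∈ Subring.center D) : x ∈ cent S :=
  mem_cent.2 fun s _ => mem_center_iff.1 hx s

/-- The multiplicative commutator `a y a⁻¹ y⁻¹`. -/
def cm (a y : D) : D := a * y * a⁻¹ * y⁻¹

/-- The additive difference `a y a⁻¹ - y`. -/
def tau (a y : D) : D := a * y * a⁻¹ - y

/-- `h` is a nonzero element with `h K h⁻¹ = K`. -/
structure Normalizes (h : D) (K : Subfield D) : Prop where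
  ne : h ≠ 0
  conj : ∀ x ∈ K, h * x * h⁻¹ ∈ K
  conj_inv : ∀ x ∈ K, h⁻¹ * x * h ∈ K

lemma Normalizes.of_mem {K : Subfield D} {h : D} (hK : h ∈ K) (h0 : h ≠ 0) : Normalizes h K :=
  ⟨h0, fun _ hx => mul_mem (mul_mem hK hx) (inv_mem hK),
    fun _ hx => mul_mem (mul_mem (inv_mem hK) hx) hK⟩

lemma Normalizes.of_comm {K : Subfield D} {h : D} (h0 : h ≠ 0) (hK : ∀ x ∈ K, h * x = x * h) :
    Normalizes h K :=
  ⟨h0, fun x hx => by rwa [hK x hx, mul_inv_cancel_right₀ h0],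
    fun x hx => by rwa [mul_assoc, ← hK x hx, inv_mul_cancel_left₀ h0]⟩

lemma Normalizes.inv {K : Subfield D} {h : D} (hK : Normalizes h K) : Normalizes h⁻¹ K :=
  ⟨inv_ne_zero hK.ne, by simpa using hK.conj_inv, by simpa using hK.conj⟩

lemma Normalizes.mul {K : Subfield D} {h g : D} (hK : Normalizes h K) (gK : Normalizes g K) :
    Normalizes (h * g) K :=
  ⟨mul_ne_zero hK.ne gK.ne,
    fun x hx => by simpa [mul_assoc] using hK.conj _ (gK.conj x hx),
    fun x hx => by simpa [mul_assoc] using gK.conj_inv _ (hK.conj_inv x hx)⟩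

lemma Normalizes.pow {K : Subfield D} {h : D} (hK : Normalizes h K) (n : ℕ) :
    Normalizes (h ^ n) K := by
  induction n with
  | zero => simpa using Normalizes.of_mem (one_mem K) one_ne_zero
  | succ n ih => rw [pow_succ]; exact ih.mul hK

/-- Conjugation by `h` maps the centralizer of `S` into itself as soon as conjugation by `h⁻¹`
maps `S` into itself. -/
lemma cent_conj_mem {S : Set D} {h : D} (h0 : h ≠ 0) (hS : ∀ s ∈ S, h⁻¹ * s * h ∈ S) {x : D}
    (hx : x ∈ cent S) : h * x * h⁻¹ ∈ cent S := by
  refine mem_cent.2 fun s hs => ?_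
  have := mem_cent.1 hx _ (hS s hs)
  calc s * (h * x * h⁻¹) = h * ((h⁻¹ * s * h) * x) * h⁻¹ := by
        simp only [mul_assoc, mul_inv_cancel_left₀ h0]
    _ = h * (x * (h⁻¹ * s * h)) * h⁻¹ := by rw [this]
    _ = h * x * h⁻¹ * s := by simp only [mul_assoc, mul_inv_cancel₀ h0, mul_one]

lemma Normalizes.cent {S : Set D} {h : D} (h0 : h ≠ 0) (hS : ∀ s ∈ S, h * s * h⁻¹ ∈ S)
    (hS' : ∀ s ∈ S, h⁻¹ * s * h ∈ S) : Normalizes h (cent S) :=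
  ⟨h0, fun _ hx => cent_conj_mem h0 hS' hx, fun x hx => by
    simpa using cent_conj_mem (inv_ne_zero h0) (by simpa using hS) hx⟩

lemma Normalizes.cent_subfield {K : Subfield D} {h : D} (hK : Normalizes h K) :
    Normalizes h (AlmostSubnormal.cent (K : Set D)) :=
  Normalizes.cent hK.ne hK.conj hK.conj_inv

/-- A commutative division subring is a field. -/
abbrev commField (P : Subfield D) (hP : ∀ x ∈ P, ∀ y ∈ P, x * y = y * x) : Field P :=
  { (inferInstance : DivisionRing P) with
    mul_comm := fun x y => Subtype.ext (hP x x.2 y y.2) }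

/-- Conjugation by a normalizing element, as an endomorphism. -/
def conjHom (P : Subfield D) {a : D} (ha : Normalizes a P) : P →+* P where
  toFun x := ⟨a * x * a⁻¹, ha.conj x x.2⟩
  map_one' := Subtype.ext (by simp [ha.ne])
  map_zero' := Subtype.ext (by simp)
  map_add' x y := Subtype.ext (by simp [mul_add, add_mul])
  map_mul' x y := Subtype.ext (by simp [mul_assoc, ha.ne])

lemma conj_eq_self_iff {a x : D} (ha : a ≠ 0) : a * x * a⁻¹ = x ↔ a * x = x * a :=
  mul_inv_eq_iff_eq_mul₀ ha

/-- The form in which `fixed_of_mulDiff_iterate` is applied: `P` is a commutative division subring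
and the endomorphism is conjugation by `a`. -/
theorem comm_of_cm_iterate (P : Subfield D) (hP : ∀ x ∈ P, ∀ y ∈ P, x * y = y * x) {a : D}
    (ha : Normalizes a P) (hinf : {t | t ∈ P ∧ a * t = t * a}.Infinite) {y : D} (hy : y ∈ P)
    (N : ℕ) (h : ∀ t ∈ P, a * t = t * a → y + t ≠ 0 → (cm a)^[N] (y + t) = 1) :
    a * y = y * a := by
  let := commField P hP
  let σ : P →+* P := conjHom P ha
  have hσ : ∀ x : P, ((σ x : P) : D) = a * x * a⁻¹ := fun _ => rfl
  have hfix : ∀ x : P, σ x = x ↔ a * (x : D) = x * a := fun x => by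
    rw [← conj_eq_self_iff ha.ne, ← hσ]
    exact Subtype.ext_iff
  have hit : ∀ (N : ℕ) (x : P), (((mulDiff σ)^[N] x : P) : D) = (cm a)^[N] (x : D) := by
    intro N
    induction N with
    | zero => intro x; rfl
    | succ N ih => intro x; rw [Function.iterate_succ_apply, ih]; rfl
  have := fixed_of_mulDiff_iterate σ (y := ⟨y, hy⟩) (N := N) ?_ ?_
  · exact (hfix _).1 this
  · intro hfin
    refine hinf ((hfin.image (Subtype.val : P → D)).subset ?_)
    rintro t ⟨ht, hat⟩
    exact ⟨⟨t, ht⟩, (hfix _).2 hat, rfl⟩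
  · intro t ht h0
    apply Subtype.ext
    rw [hit]
    exact h t t.2 ((hfix t).1 ht) fun h' => h0 (Subtype.ext h')

end Basic

/-! ### Spans of powers of a normalizing element -/

section Span

variable {D : Type*} [DivisionRing D] (V : Subfield D) (z : D)

/-- The left `V`-span of the powers `z ^ i`, `i < d`. -/
def spanLT (d : ℕ) : Submodule V D := Submodule.span V {x | ∃ i < d, x = z ^ i}

/-- The left `V`-span of the powers `z ^ i`, `i ≥ k`. -/
def spanGE (k : ℕ) : Submodule V D := Submodule.span V {x | ∃ i ≥ k, x = z ^ i}

variable {V z}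

lemma smul_mem_of_mem {M : Submodule V D} {v x : D} (hv : v ∈ V) (hx : x ∈ M) : v * x ∈ M :=
  M.smul_mem (⟨v, hv⟩ : V) hx

lemma span_mul_mem {S T : Set D} {M : Submodule V D}
    (hS : ∀ s ∈ S, ∀ v ∈ V, ∃ v' ∈ V, s * v = v' * s) (h : ∀ s ∈ S, ∀ t ∈ T, s * t ∈ M)
    {x y : D} (hx : x ∈ Submodule.span V S) (hy : y ∈ Submodule.span V T) : x * y ∈ M := by
  induction hx using Submodule.span_induction with
  | zero => simp
  | add a b _ _ ha hb => rw [add_mul]; exact M.add_mem ha hb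
  | smul v a _ ha =>
    rw [Subfield.smul_def, smul_eq_mul, mul_assoc]
    exact smul_mem_of_mem v.2 ha
  | mem s hs =>
    induction hy using Submodule.span_induction with
    | zero => simp
    | add a b _ _ ha hb => rw [mul_add]; exact M.add_mem ha hb
    | mem t ht => exact h s hs t ht
    | smul v a _ ha =>
      obtain ⟨v', hv', he⟩ := hS s hs v v.2
      rw [Subfield.smul_def, smul_eq_mul, ← mul_assoc, he, mul_assoc]
      exact smul_mem_of_mem hv' ha

lemma Normalizes.exists_pow_mul (hz : Normalizes z V) (i : ℕ) {v : D} (hv : v ∈ V) :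
    ∃ v' ∈ V, z ^ i * v = v' * z ^ i :=
  ⟨_, (hz.pow i).conj v hv, by rw [inv_mul_cancel_right₀ (hz.pow i).ne]⟩

lemma pow_mem_spanLT {i d : ℕ} (h : i < d) : z ^ i ∈ spanLT V z d :=
  Submodule.subset_span ⟨i, h, rfl⟩

lemma pow_mem_spanGE {i k : ℕ} (h : k ≤ i) : z ^ i ∈ spanGE V z k :=
  Submodule.subset_span ⟨i, h, rfl⟩

lemma spanLT_mono {d e : ℕ} (h : d ≤ e) : spanLT V z d ≤ spanLT V z e :=
  Submodule.span_mono fun _ ⟨i, hi, hx⟩ => ⟨i, hi.trans_le h, hx⟩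

lemma spanGE_anti {d e : ℕ} (h : d ≤ e) : spanGE V z e ≤ spanGE V z d :=
  Submodule.span_mono fun _ ⟨i, hi, hx⟩ => ⟨i, h.trans hi, hx⟩

lemma spanLT_mul (hz : Normalizes z V) {d e : ℕ} {x y : D} (hx : x ∈ spanLT V z d)
    (hy : y ∈ spanLT V z e) : x * y ∈ spanLT V z (d + e) := by
  refine span_mul_mem ?_ ?_ hx hy
  · rintro _ ⟨i, _, rfl⟩ v hv
    exact hz.exists_pow_mul i hv
  · rintro _ ⟨i, hi, rfl⟩ _ ⟨j, hj, rfl⟩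
    rw [← pow_add]
    exact pow_mem_spanLT (by omega)

lemma spanGE_mul (hz : Normalizes z V) {d e : ℕ} {x y : D} (hx : x ∈ spanGE V z d)
    (hy : y ∈ spanGE V z e) : x * y ∈ spanGE V z (d + e) := by
  refine span_mul_mem ?_ ?_ hx hy
  · rintro _ ⟨i, _, rfl⟩ v hv
    exact hz.exists_pow_mul i hv
  · rintro _ ⟨i, hi, rfl⟩ _ ⟨j, hj, rfl⟩
    rw [← pow_add]
    exact pow_mem_spanGE (by omega)

lemma spanLT_le_spanGE (d : ℕ) : spanLT V z d ≤ spanGE V z 0 :=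
  Submodule.span_mono fun _ ⟨i, _, hx⟩ => ⟨i, Nat.zero_le _, hx⟩

lemma mem_spanGE_zero {v : D} (hv : v ∈ V) : v ∈ spanGE V z 0 := by
  simpa using smul_mem_of_mem hv (pow_mem_spanGE (V := V) (z := z) (le_refl 0))

lemma mem_spanLT_of_mem {v : D} (hv : v ∈ V) {d : ℕ} (hd : 0 < d) : v ∈ spanLT V z d := by
  simpa using smul_mem_of_mem hv (pow_mem_spanLT (V := V) (z := z) hd)

lemma mem_spanLT_iff {d : ℕ} {x : D} :
    x ∈ spanLT V z d ↔ ∃ c : Fin d → V, ∑ i, (c i : D) * z ^ (i : ℕ) = x := by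
  have : {x | ∃ i < d, x = z ^ i} = Set.range fun i : Fin d => z ^ (i : ℕ) := by
    ext y
    constructor
    · rintro ⟨i, hi, rfl⟩
      exact ⟨⟨i, hi⟩, rfl⟩
    · rintro ⟨i, rfl⟩
      exact ⟨i, i.2, rfl⟩
  rw [spanLT, this, Submodule.mem_span_range_iff_exists_fun]
  rfl

instance (d : ℕ) : Module.Finite V (spanLT V z d) := by
  have : ({x | ∃ i < d, x = z ^ i} : Set D).Finite := by
    have : {x | ∃ i < d, x = z ^ i} = (fun i => z ^ i) '' Set.Iio d := by
      ext y
      simp [eq_comm]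
    rw [this]
    exact (Set.finite_Iio d).image _
  exact Module.Finite.span_of_finite V this

/-- If `z` normalizes `V` and `z ^ r` is a left `V`-combination of lower powers, these combinations
form a division subring. -/
def spanSubfield (hz : Normalizes z V) {r : ℕ} (hr : z ^ r ∈ spanLT V z r) : Subfield D := by
  have hr0 : 0 < r := by
    rcases Nat.eq_zero_or_pos r with rfl | h
    · simp [spanLT] at hr
    · exact h
  have hpow : ∀ n, z ^ n ∈ spanLT V z r := by
    intro n
    induction n with
    | zero => exact pow_mem_spanLT hr0
    | succ n ih =>
      rw [pow_succ']
      refine span_mul_mem (S := {z}) ?_ ?_ (Submodule.subset_span rfl) ih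
      · rintro _ rfl v hv
        simpa using hz.exists_pow_mul 1 hv
      · rintro _ rfl _ ⟨i, hi, rfl⟩
        rw [← pow_succ']
        rcases Nat.lt_or_ge (i + 1) r with h | h
        · exact pow_mem_spanLT h
        · rwa [show i + 1 = r by omega]
  have hmul : ∀ {x y : D}, x ∈ spanLT V z r → y ∈ spanLT V z r → x * y ∈ spanLT V z r := by
    intro x y hx hy
    refine span_mul_mem ?_ ?_ hx hy
    · rintro _ ⟨i, _, rfl⟩ v hv
      exact hz.exists_pow_mul i hv
    · rintro _ ⟨i, hi, rfl⟩ _ ⟨j, hj, rfl⟩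
      rw [← pow_add]
      exact hpow _
  exact
  { carrier := spanLT V z r
    mul_mem' := hmul
    one_mem' := by simpa using hpow 0
    add_mem' := fun hx hy => Submodule.add_mem _ hx hy
    zero_mem' := Submodule.zero_mem _
    neg_mem' := fun hx => Submodule.neg_mem _ hx
    inv_mem' := by
      intro w hw
      by_cases hw0 : w = 0
      · rw [hw0, inv_zero]
        exact Submodule.zero_mem _
      let f : spanLT V z r →ₗ[V] spanLT V z r :=
        { toFun := fun x => ⟨x * w, hmul x.2 hw⟩
          map_add' := fun x y => Subtype.ext (add_mul _ _ _)
          map_smul' := fun v x => Subtype.ext (mul_assoc _ _ _) }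
      have hf : Function.Injective f := by
        intro x y hxy
        exact Subtype.ext (mul_right_cancel₀ hw0 (congrArg Subtype.val hxy))
      obtain ⟨x, hx⟩ := LinearMap.injective_iff_surjective.1 hf ⟨1, by simpa using hpow 0⟩
      have hx' : (x : D) * w = 1 := congrArg Subtype.val hx
      rw [← eq_inv_of_mul_eq_one_left hx']
      exact x.2 }

lemma mem_spanSubfield (hz : Normalizes z V) {r : ℕ} (hr : z ^ r ∈ spanLT V z r) {x : D} :
    x ∈ spanSubfield hz hr ↔ x ∈ spanLT V z r := Iff.rfl

end Span

/-! ### Conjugations of finite order on commutative division subrings -/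

section FiniteOrder

open Polynomial in
/-- A field is finite if the fixed field of an endomorphism of finite order is: every element is a
root of a polynomial of bounded degree over the fixed field. -/
lemma finite_of_fixed_finite {P : Type*} [Field P] (σ : P →+* P) {r : ℕ} (hr : 0 < r)
    (hσ : ∀ x, σ^[r] x = x) (hfin : {t | σ t = t}.Finite) : Finite P := by
  classical
  have hroots := Polynomial.bUnion_roots_finite (RingHom.id P) r hfin
  refine Set.finite_univ_iff.1 (hroots.subset fun x _ => ?_)
  let p : P[X] := ∏ i ∈ Finset.range r, (X - C (σ^[i] x))
  have hp : p.Monic := monic_prod_of_monic _ _ fun i _ => monic_X_sub_C _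
  have hmap : p.map σ = p := by
    simp only [p, Polynomial.map_prod, Polynomial.map_sub, map_X, map_C]
    obtain ⟨m, rfl⟩ : ∃ m, r = m + 1 := ⟨r - 1, by omega⟩
    rw [Finset.prod_range_succ, Finset.prod_range_succ' (fun i => X - C (σ^[i] x))]
    congr 1
    · refine Finset.prod_congr rfl fun i _ => ?_
      rw [Function.iterate_succ_apply']
    · rw [← Function.iterate_succ_apply' σ, hσ]
      rfl
  simp only [Set.mem_iUnion]
  refine ⟨p, ⟨?_, fun i => ?_⟩, ?_⟩
  · refine (natDegree_prod_le _ _).trans ?_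
    simp
  · have := congrArg (fun q => q.coeff i) hmap
    simpa [coeff_map] using this
  · simp only [Polynomial.map_id, Finset.mem_coe, Multiset.mem_toFinset]
    rw [mem_roots hp.ne_zero, IsRoot.def]
    simp only [p, eval_prod]
    exact Finset.prod_eq_zero (Finset.mem_range.2 hr) (by simp)

variable {D : Type*} [DivisionRing D]

lemma finite_of_comm_fixed_finite (P : Subfield D) (hP : ∀ x ∈ P, ∀ y ∈ P, x * y = y * x) {a : D}
    (ha : Normalizes a P) {r : ℕ} (hr : 0 < r) (har : ∀ x ∈ P, a ^ r * x = x * a ^ r)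
    (hfin : {t | t ∈ P ∧ a * t = t * a}.Finite) : Finite P := by
  let := commField P hP
  let σ : P →+* P := conjHom P ha
  have hσ : ∀ x : P, ((σ x : P) : D) = a * x * a⁻¹ := fun _ => rfl
  have hit : ∀ (i : ℕ) (x : P), ((σ^[i] x : P) : D) = a ^ i * x * (a ^ i)⁻¹ := by
    intro i
    induction i with
    | zero => intro x; simp
    | succ i ih =>
      intro x
      rw [Function.iterate_succ_apply', hσ, ih, pow_succ' a i]
      simp [mul_assoc]
  refine finite_of_fixed_finite σ hr (fun x => Subtype.ext ?_) ?_
  · rw [hit]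
    exact (conj_eq_self_iff (pow_ne_zero r ha.ne)).2 (har x x.2)
  · refine Set.Finite.of_finite_image (f := (Subtype.val : P → D)) (hfin.subset ?_)
      Subtype.val_injective.injOn
    rintro _ ⟨t, ht, rfl⟩
    refine ⟨t.2, (conj_eq_self_iff ha.ne).1 ?_⟩
    exact congrArg Subtype.val ht

/-- If `a` normalizes a finite commutative division subring `P` and has a power in `P`, then `a` and
`P` generate a finite division ring, so they commute by Wedderburn's theorem. -/
theorem comm_of_finite (P : Subfield D) [Finite P] {a : D} (ha : Normalizes a P) {r : ℕ}
    (hr : 0 < r) (har : a ^ r ∈ P) {y : D} (hy : y ∈ P) : a * y = y * a := by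
  have hr' : a ^ (r + 1) ∈ spanLT P a (r + 1) := by
    rw [pow_succ]
    simpa using smul_mem_of_mem har (pow_mem_spanLT (V := P) (z := a) (show 1 < r + 1 by omega))
  let E := spanSubfield ha hr'
  have : Finite E := Module.finite_of_finite P (M := spanLT P a (r + 1))
  have hcomm := (Finite.isDomain_to_isField E).mul_comm
  have haE : a ∈ E := by
    have := pow_mem_spanLT (V := P) (z := a) (show 1 < r + 1 by omega)
    rwa [pow_one] at this
  have hyE : y ∈ E := mem_spanLT_of_mem hy (by omega)
  exact congrArg Subtype.val (hcomm ⟨a, haE⟩ ⟨y, hyE⟩)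

/-- A conjugation of finite order on a commutative division subring `P` with a power of the
conjugating element in `P` is trivial or has infinitely many fixed elements. -/
theorem comm_of_fixed_finite (P : Subfield D) (hP : ∀ x ∈ P, ∀ y ∈ P, x * y = y * x) {a : D}
    (ha : Normalizes a P) {r : ℕ} (hr : 0 < r) (har : a ^ r ∈ P)
    (hfin : {t | t ∈ P ∧ a * t = t * a}.Finite) {y : D} (hy : y ∈ P) : a * y = y * a :=
  have := finite_of_comm_fixed_finite P hP ha hr (fun x hx => hP _ har x hx) hfin
  comm_of_finite P ha hr har hy

end FiniteOrder

/-! ### First order expansions -/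

section FirstOrder

variable {D : Type*} [DivisionRing D] {V : Subfield D} {z : D}

lemma exists_mem_spanLT {x : D} (hx : x ∈ spanGE V z 0) : ∃ d, x ∈ spanLT V z d := by
  induction hx using Submodule.span_induction with
  | mem x hx =>
    obtain ⟨i, _, rfl⟩ := hx
    exact ⟨i + 1, pow_mem_spanLT i.lt_succ_self⟩
  | zero => exact ⟨0, Submodule.zero_mem _⟩
  | add x y _ _ hx hy =>
    obtain ⟨d, hd⟩ := hx
    obtain ⟨e, he⟩ := hy
    exact ⟨max d e, Submodule.add_mem _ (spanLT_mono (le_max_left _ _) hd)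
      (spanLT_mono (le_max_right _ _) he)⟩
  | smul v x _ hx =>
    obtain ⟨d, hd⟩ := hx
    exact ⟨d, Submodule.smul_mem _ v hd⟩

lemma mul_mem_spanGE (hz : Normalizes z V) {k : ℕ} {x y : D} (hx : x ∈ spanGE V z 0)
    (hy : y ∈ spanGE V z k) : x * y ∈ spanGE V z k := by
  simpa using spanGE_mul hz hx hy

lemma mem_spanGE_mul (hz : Normalizes z V) {k : ℕ} {x y : D} (hx : x ∈ spanGE V z k)
    (hy : y ∈ spanGE V z 0) : x * y ∈ spanGE V z k := by
  simpa using spanGE_mul hz hx hy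

lemma mul_mem_spanGE_two (hz : Normalizes z V) {x y : D} (hx : x ∈ spanGE V z 1)
    (hy : y ∈ spanGE V z 1) : x * y ∈ spanGE V z 2 := by
  have := spanGE_mul hz hx hy
  rwa [one_add_one_eq_two] at this

lemma z_mul_mem_spanGE (hz : Normalizes z V) {x : D} (hx : x ∈ spanGE V z 0) :
    z * x ∈ spanGE V z 1 := by
  have := mem_spanGE_mul hz (pow_mem_spanGE (V := V) (z := z) (le_refl 1)) hx
  rwa [pow_one] at this

/-- Splitting off the constant term. -/
lemma exists_eq_add_mul (hz : Normalizes z V) {d : ℕ} {x : D} (hx : x ∈ spanLT V z (d + 1)) :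
    ∃ v ∈ V, ∃ y ∈ spanLT V z d, x = v + z * y := by
  induction hx using Submodule.span_induction with
  | mem x hx =>
    obtain ⟨i, hi, rfl⟩ := hx
    cases i with
    | zero => exact ⟨1, one_mem V, 0, Submodule.zero_mem _, by simp⟩
    | succ i => exact ⟨0, zero_mem V, z ^ i, pow_mem_spanLT (by omega), by rw [zero_add, pow_succ']⟩
  | zero => exact ⟨0, zero_mem V, 0, Submodule.zero_mem _, by simp⟩
  | add x y _ _ hx hy =>
    obtain ⟨v, hv, x', hx', rfl⟩ := hx
    obtain ⟨w, hw, y', hy', rfl⟩ := hy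
    exact ⟨v + w, add_mem hv hw, x' + y', Submodule.add_mem _ hx' hy', by rw [mul_add]; abel⟩
  | smul u x _ hx =>
    obtain ⟨v, hv, x', hx', rfl⟩ := hx
    refine ⟨u * v, mul_mem u.2 hv, (z⁻¹ * u * z) * x', smul_mem_of_mem (hz.conj_inv u u.2) hx', ?_⟩
    rw [Subfield.smul_def, smul_eq_mul, mul_add]
    simp only [mul_assoc, mul_inv_cancel_left₀ hz.ne]

lemma exists_sub_mem (hz : Normalizes z V) {x : D} (hx : x ∈ spanGE V z 0) :
    ∃ v ∈ V, x - v ∈ spanGE V z 1 := by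
  obtain ⟨d, hd⟩ := exists_mem_spanLT hx
  obtain ⟨v, hv, y, hy, rfl⟩ := exists_eq_add_mul hz (spanLT_mono d.le_succ hd)
  exact ⟨v, hv, by simpa using z_mul_mem_spanGE hz (spanLT_le_spanGE _ hy)⟩

variable (hz : Normalizes z V) (hind : LinearIndependent V fun i : ℕ => z ^ i)

include hind in
lemma eq_zero_of_mul_pow_mem {v : D} (hv : v ∈ V) {i : ℕ} (h : v * z ^ i ∈ spanGE V z (i + 1)) :
    v = 0 := by
  have := linearIndependent_iff_eq_zero_of_smul_mem_span.1 hind i ⟨v, hv⟩ ?_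
  · exact congrArg Subtype.val this
  · refine Submodule.span_mono ?_ h
    rintro _ ⟨j, hj, rfl⟩
    exact ⟨j, ⟨Set.mem_univ _, by rintro rfl; omega⟩, rfl⟩

include hind in
lemma eq_zero_of_mem_spanGE_one {v : D} (hv : v ∈ V) (h : v ∈ spanGE V z 1) : v = 0 :=
  eq_zero_of_mul_pow_mem hind hv (i := 0) (by simpa using h)

include hz hind in
lemma exists_eq_z_mul {d : ℕ} {x : D} (hx : x ∈ spanLT V z (d + 1)) (h1 : x ∈ spanGE V z 1) :
    ∃ y ∈ spanLT V z d, x = z * y := by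
  obtain ⟨v, hv, y, hy, rfl⟩ := exists_eq_add_mul hz hx
  have : v ∈ spanGE V z 1 := by
    simpa using Submodule.sub_mem _ h1 (z_mul_mem_spanGE hz (spanLT_le_spanGE _ hy))
  exact ⟨y, hy, by rw [eq_zero_of_mem_spanGE_one hind hv this, zero_add]⟩

include hz hind in
lemma mem_or_mem_of_mul_mem {x y : D} (hx : x ∈ spanGE V z 0) (hy : y ∈ spanGE V z 0)
    (hxy : x * y ∈ spanGE V z 1) : x ∈ spanGE V z 1 ∨ y ∈ spanGE V z 1 := by
  obtain ⟨v, hv, hxv⟩ := exists_sub_mem hz hx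
  obtain ⟨w, hw, hyw⟩ := exists_sub_mem hz hy
  have h : v * w ∈ spanGE V z 1 := by
    have h1 := mem_spanGE_mul hz hxv hy
    have h2 := mul_mem_spanGE hz (mem_spanGE_zero hv) hyw
    have h3 := Submodule.sub_mem _ (Submodule.sub_mem _ hxy h1) h2
    convert h3 using 1
    noncomm_ring
  rcases mul_eq_zero.1 (eq_zero_of_mem_spanGE_one hind (mul_mem hv hw) h) with rfl | rfl
  · left; simpa using hxv
  · right; simpa using hyw

include hind in
lemma finrank_spanLT (d : ℕ) : Module.finrank V (spanLT V z d) = d := by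
  have : spanLT V z d = Submodule.span V (Set.range fun i : Fin d => z ^ (i : ℕ)) := by
    ext x
    rw [mem_spanLT_iff, Submodule.mem_span_range_iff_exists_fun]
    rfl
  rw [this]
  exact (finrank_span_eq_card (hind.comp _ Fin.val_injective)).trans (Fintype.card_fin d)

include hz hind in
/-- The left Ore condition for the ring of polynomial expressions in `z`, with multipliers that do
not both have constant term zero. -/
lemma exists_ore {p q : D} (hp : p ∈ spanGE V z 0) (hq : q ∈ spanGE V z 0) :
    ∃ s ∈ spanGE V z 0, ∃ r ∈ spanGE V z 0, s * p = r * q ∧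
      (s ∈ spanGE V z 1 → r ∉ spanGE V z 1) := by
  classical
  have hex : ∃ d, ∃ s ∈ spanLT V z d, ∃ r ∈ spanLT V z d, (s, r) ≠ 0 ∧ s * p = r * q := by
    obtain ⟨a, ha⟩ := exists_mem_spanLT hp
    obtain ⟨b, hb⟩ := exists_mem_spanLT hq
    set m := max a b
    have hp' : p ∈ spanLT V z m := spanLT_mono (le_max_left _ _) ha
    have hq' : q ∈ spanLT V z m := spanLT_mono (le_max_right _ _) hb
    let f : (spanLT V z (m + 1) × spanLT V z (m + 1)) →ₗ[V] spanLT V z (m + 1 + m) :=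
      { toFun := fun x => ⟨x.1 * p - x.2 * q,
          Submodule.sub_mem _ (spanLT_mul hz x.1.2 hp') (spanLT_mul hz x.2.2 hq')⟩
        map_add' := fun x y => Subtype.ext (by simp; noncomm_ring)
        map_smul' := fun v x => Subtype.ext (by
          simp [Subfield.smul_def, mul_assoc, mul_sub]) }
    have hker : f.ker ≠ ⊥ := by
      apply LinearMap.ker_ne_bot_of_finrank_lt
      rw [Module.finrank_prod, finrank_spanLT hind, finrank_spanLT hind]
      omega
    obtain ⟨⟨s, r⟩, hsr, hne⟩ := Submodule.exists_mem_ne_zero_of_ne_bot hker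
    refine ⟨m + 1, s, s.2, r, r.2, ?_, ?_⟩
    · intro h
      apply hne
      rw [Prod.mk_eq_zero] at h ⊢
      exact ⟨Subtype.ext h.1, Subtype.ext h.2⟩
    · exact sub_eq_zero.1 (congrArg Subtype.val (LinearMap.mem_ker.1 hsr))
  obtain ⟨s, hs, r, hr, hne, he⟩ := Nat.find_spec hex
  refine ⟨s, spanLT_le_spanGE _ hs, r, spanLT_le_spanGE _ hr, he, fun hs1 hr1 => ?_⟩
  obtain ⟨d, hd⟩ : ∃ d, Nat.find hex = d + 1 := by
    refine Nat.exists_eq_succ_of_ne_zero fun h0 => hne ?_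
    rw [h0] at hs hr
    simp [spanLT] at hs hr
    simp [hs, hr]
  rw [hd] at hs hr
  obtain ⟨s', hs', rfl⟩ := exists_eq_z_mul hz hind hs hs1
  obtain ⟨r', hr', rfl⟩ := exists_eq_z_mul hz hind hr hr1
  refine Nat.find_min hex (show d < _ by omega) ⟨s', hs', r', hr', ?_, ?_⟩
  · intro h
    rw [Prod.mk_eq_zero] at h
    simp [h.1, h.2] at hne
  · exact mul_left_cancel₀ hz.ne (by simpa [mul_assoc] using he)

variable (V z) in
/-- `FirstOrder V z φ w` says that `φ` is a left fraction `q⁻¹ p` of polynomial expressions in `z`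
with left coefficients in `V`, regular at `z = 0`, and that `φ = 1 + w + O(z ^ 2)`. Here `w` is
meant to be a multiple of `z`. -/
def FirstOrder (φ w : D) : Prop :=
  ∃ p ∈ spanGE V z 0, ∃ q ∈ spanGE V z 0, q ∉ spanGE V z 1 ∧ q * φ = p ∧
    p - q * (1 + w) ∈ spanGE V z 2

lemma one_mem_spanGE : (1 : D) ∈ spanGE V z 0 := mem_spanGE_zero (one_mem V)

include hz in
lemma sub_mem_of_firstOrder {p q w : D} (hq : q ∈ spanGE V z 0) (hw : w ∈ spanGE V z 1)
    (h : p - q * (1 + w) ∈ spanGE V z 2) : p - q ∈ spanGE V z 1 := by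
  have h1 := Submodule.add_mem _ (spanGE_anti (show 1 ≤ 2 by omega) h) (mul_mem_spanGE hz hq hw)
  convert h1 using 1
  noncomm_ring

namespace FirstOrder

include hz in
lemma ne_zero {φ w : D} (h : FirstOrder V z φ w) (hw : w ∈ spanGE V z 1) : φ ≠ 0 := by
  rintro rfl
  obtain ⟨p, _, q, hq, hq1, he, h2⟩ := h
  have := sub_mem_of_firstOrder hz hq hw h2
  rw [← he, mul_zero, zero_sub, Submodule.neg_mem_iff] at this
  exact hq1 this

include hind in
lemma one_add {w : D} (hw : w ∈ spanGE V z 1) : FirstOrder V z (1 + w) w := by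
  refine ⟨1 + w, Submodule.add_mem _ one_mem_spanGE (spanGE_anti (Nat.zero_le _) hw), 1,
    one_mem_spanGE, fun h => ?_, one_mul _, by simp⟩
  exact one_ne_zero (eq_zero_of_mem_spanGE_one hind (one_mem V) h)

include hz hind in
lemma mul {φ w ψ x : D} (h : FirstOrder V z φ w) (h' : FirstOrder V z ψ x)
    (hw : w ∈ spanGE V z 1) (hx : x ∈ spanGE V z 1) : FirstOrder V z (φ * ψ) (w + x) := by
  obtain ⟨p, hp, q, hq, hq1, he, h2⟩ := h
  obtain ⟨p', hp', q', hq', hq1', he', h2'⟩ := h'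
  obtain ⟨s, hs, r, hr, hsr, hne⟩ := exists_ore hz hind hp hq'
  have hs1 : s ∉ spanGE V z 1 := by
    intro hs1
    have hrq : r * q' ∈ spanGE V z 1 := by
      rw [← hsr]
      exact mem_spanGE_mul hz hs1 hp
    rcases mem_or_mem_of_mul_mem hz hind hr hq' hrq with h | h
    · exact hne hs1 h
    · exact hq1' h
  have hx0 : x ∈ spanGE V z 0 := spanGE_anti (Nat.zero_le _) hx
  refine ⟨r * p', mul_mem_spanGE hz hr hp', s * q, mul_mem_spanGE hz hs hq, fun h => ?_, ?_, ?_⟩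
  · exact (mem_or_mem_of_mul_mem hz hind hs hq h).elim hs1 hq1
  · rw [← he', ← mul_assoc r, ← hsr, ← he]
    simp only [mul_assoc]
  · have e : r * p' - s * q * (1 + (w + x)) =
        r * (p' - q' * (1 + x)) + s * ((p - q * (1 + w)) * (1 + x)) + s * (q * (w * x)) := by
      have : r * (q' * (1 + x)) = s * (p * (1 + x)) := by rw [← mul_assoc, ← hsr, mul_assoc]
      rw [mul_sub r, this]
      noncomm_ring
    rw [e]
    refine Submodule.add_mem _ (Submodule.add_mem _ (mul_mem_spanGE hz hr h2') ?_) ?_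
    · exact mul_mem_spanGE hz hs (mem_spanGE_mul hz h2 (Submodule.add_mem _ one_mem_spanGE hx0))
    · exact mul_mem_spanGE hz hs (mul_mem_spanGE hz hq (mul_mem_spanGE_two hz hw hx))

include hz in
lemma inv {φ w : D} (h : FirstOrder V z φ w) (hw : w ∈ spanGE V z 1) :
    FirstOrder V z φ⁻¹ (-w) := by
  have h0 := h.ne_zero hz hw
  obtain ⟨p, hp, q, hq, hq1, he, h2⟩ := h
  have hw0 : w ∈ spanGE V z 0 := spanGE_anti (Nat.zero_le _) hw
  refine ⟨q, hq, p, hp, fun hp1 => hq1 ?_, by rw [← he, mul_inv_cancel_right₀ h0], ?_⟩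
  · have := Submodule.sub_mem _ hp1 (sub_mem_of_firstOrder hz hq hw h2)
    simpa using this
  · have e : q - p * (1 + -w) = -((p - q * (1 + w)) * (1 - w)) + q * (w * w) := by noncomm_ring
    rw [e]
    exact Submodule.add_mem _ (Submodule.neg_mem _ (mem_spanGE_mul hz h2
      (Submodule.sub_mem _ one_mem_spanGE hw0)))
      (mul_mem_spanGE hz hq (mul_mem_spanGE_two hz hw hw))

include hz hind in
lemma eq_zero_of_one {k : D} (hk : k ∈ V) (h : FirstOrder V z 1 (k * z)) : k = 0 := by
  obtain ⟨p, hp, q, hq, hq1, he, h2⟩ := h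
  have hkz : k * z ∈ spanGE V z 1 := by
    have := smul_mem_of_mem hk (pow_mem_spanGE (V := V) (z := z) (le_refl 1))
    rwa [pow_one] at this
  rw [mul_one] at he
  subst he
  obtain ⟨v, hv, hqv⟩ := exists_sub_mem hz hq
  have h3 : v * k * z ^ 1 ∈ spanGE V z (1 + 1) := by
    rw [one_add_one_eq_two]
    have := Submodule.neg_mem _ (Submodule.add_mem _ h2 (mul_mem_spanGE_two hz hqv hkz))
    convert this using 1
    noncomm_ring
  rcases mul_eq_zero.1 (eq_zero_of_mul_pow_mem hind (mul_mem hv hk) h3) with rfl | h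
  · simp [hq1] at hqv
  · exact h

include hz hind in
lemma eq_one_of_mem {ψ w : D} (hψ : ψ ∈ V) (hw : w ∈ spanGE V z 1) (h : FirstOrder V z ψ w) :
    ψ = 1 := by
  obtain ⟨p, hp, q, hq, hq1, he, h2⟩ := h
  have h3 := sub_mem_of_firstOrder hz hq hw h2
  have h4 : q * (ψ - 1) ∈ spanGE V z 1 := by rwa [mul_sub, mul_one, he]
  have hψ1 : ψ - 1 ∈ V := sub_mem hψ (one_mem V)
  rcases mem_or_mem_of_mul_mem hz hind hq (mem_spanGE_zero hψ1) h4 with h | h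
  · exact absurd h hq1
  · exact sub_eq_zero.1 (eq_zero_of_mem_spanGE_one hind hψ1 h)

end FirstOrder

lemma conj_mem_spanGE (hz : Normalizes z V) {h : D} (hV : Normalizes h V)
    (hhz : h * z * h⁻¹ ∈ spanGE V z 1)
    {k : ℕ} {x : D} (hx : x ∈ spanGE V z k) : h * x * h⁻¹ ∈ spanGE V z k := by
  induction hx using Submodule.span_induction with
  | mem x hx =>
    obtain ⟨i, hi, rfl⟩ := hx
    refine spanGE_anti hi ?_
    clear hi
    induction i with
    | zero => simpa [hV.ne] using one_mem_spanGE
    | succ i ih =>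
      convert spanGE_mul hz ih hhz using 1
      simp only [pow_succ, mul_assoc, inv_mul_cancel_left₀ hV.ne]
  | zero => simp
  | add x y _ _ hx hy => rw [mul_add, add_mul]; exact Submodule.add_mem _ hx hy
  | smul v x _ hx =>
    have := smul_mem_of_mem (hV.conj v v.2) hx
    convert this using 1
    simp only [Subfield.smul_def, smul_eq_mul, mul_assoc, inv_mul_cancel_left₀ hV.ne]

/-- If conjugation by `h` multiplies `z` by an element of `V`, so does conjugation by `h⁻¹`. -/
lemma conj_inv_mem_spanGE {h k : D} (hV : Normalizes h V) (hk : k ∈ V) (hk0 : k ≠ 0)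
    (hhz : h * z * h⁻¹ = k * z) : h⁻¹ * z * h ∈ spanGE V z 1 := by
  have h0 := hV.ne
  have e : h⁻¹ * z * h = (h⁻¹ * k * h)⁻¹ * z := by
    have h1 : h * z = k * z * h := by rw [← hhz, inv_mul_cancel_right₀ h0]
    have h2 : h⁻¹ * k * h * (h⁻¹ * z * h) = z := by
      simp only [mul_assoc, mul_inv_cancel_left₀ h0]
      rw [← mul_assoc k, ← h1, inv_mul_cancel_left₀ h0]
    have h3 : h⁻¹ * k * h ≠ 0 := mul_ne_zero (mul_ne_zero (inv_ne_zero h0) hk0) h0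
    rw [eq_inv_mul_iff_mul_eq₀ h3, h2]
  rw [e]
  have := smul_mem_of_mem (inv_mem (hV.conj_inv k hk))
    (pow_mem_spanGE (V := V) (z := z) (le_refl 1))
  rwa [pow_one] at this

lemma FirstOrder.conj (hz : Normalizes z V) {h : D} (hV : Normalizes h V)
    (h1 : h * z * h⁻¹ ∈ spanGE V z 1)
    (h2 : h⁻¹ * z * h ∈ spanGE V z 1) {φ w : D} (hφ : FirstOrder V z φ w) :
    FirstOrder V z (h * φ * h⁻¹) (h * w * h⁻¹) := by
  have h0 := hV.ne
  obtain ⟨p, hp, q, hq, hq1, rfl, h3⟩ := hφ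
  refine ⟨_, conj_mem_spanGE hz hV h1 hp, h * q * h⁻¹, conj_mem_spanGE hz hV h1 hq, fun h4 => ?_,
    by simp only [mul_assoc, inv_mul_cancel_left₀ h0], ?_⟩
  · have := conj_mem_spanGE hz hV.inv (by simpa using h2) h4
    apply hq1
    convert this using 1
    simp only [mul_assoc, inv_inv, inv_mul_cancel_left₀ h0, inv_mul_cancel₀ h0, mul_one]
  · convert conj_mem_spanGE hz hV h1 h3 using 1
    simp only [mul_sub, sub_mul, mul_add, add_mul, mul_assoc, inv_mul_cancel_left₀ h0, mul_one]

include hz hind in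
/-- First order expansion of an iterated commutator. -/
lemma FirstOrder.cm_iterate {h k : D} (hV : Normalizes h V) (hk : k ∈ V) (hk0 : k ≠ 0)
    (hhz : h * z * h⁻¹ = k * z) (n : ℕ) {v : D} (hv : v ∈ V) :
    FirstOrder V z ((cm h)^[n] (1 + v * z)) ((tau h)^[n] (v * z)) ∧
      ∃ x ∈ V, (tau h)^[n] (v * z) = x * z := by
  have hmem : ∀ x ∈ V, x * z ∈ spanGE V z 1 := fun x hx => by
    have := smul_mem_of_mem hx (pow_mem_spanGE (V := V) (z := z) (le_refl 1))
    rwa [pow_one] at this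
  have h1 : h * z * h⁻¹ ∈ spanGE V z 1 := hhz ▸ hmem k hk
  have h2 := conj_inv_mem_spanGE hV hk hk0 hhz
  induction n with
  | zero => exact ⟨FirstOrder.one_add hind (hmem v hv), v, hv, rfl⟩
  | succ n ih =>
    obtain ⟨ih, x, hx, hxe⟩ := ih
    rw [Function.iterate_succ_apply', Function.iterate_succ_apply']
    have hxm := hmem x hx
    rw [← hxe] at hxm
    constructor
    · rw [cm, tau, sub_eq_add_neg]
      exact (ih.conj hz hV h1 h2).mul hz hind (ih.inv hz hxm)
        (conj_mem_spanGE hz hV h1 hxm) (Submodule.neg_mem _ hxm)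
    · refine ⟨h * x * h⁻¹ * k - x, sub_mem (mul_mem (hV.conj x hx) hk) hx, ?_⟩
      rw [hxe, tau, sub_mul, mul_assoc _ k, ← hhz]
      simp only [mul_assoc, inv_mul_cancel_left₀ hV.ne]

include hz hind in
/-- If the iterated commutator `(cm h)^[n] (1 + v z)` normalizes `V`, then it centralizes `V` to
first order in `z`: its commutators with elements of `V` have constant term `1` and lie in `V`, so they
are trivial. -/
theorem commute_tau_iterate {h k : D} (hV : Normalizes h V) (hk : k ∈ V) (hk0 : k ≠ 0)
    (hhz : h * z * h⁻¹ = k * z) (n : ℕ) {v : D} (hv : v ∈ V)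
    (hu : Normalizes ((cm h)^[n] (1 + v * z)) V) :
    ∀ b ∈ V, b * (tau h)^[n] (v * z) = (tau h)^[n] (v * z) * b := by
  intro b hb
  by_cases hb0 : b = 0
  · simp [hb0]
  obtain ⟨hF, x, hx, hxe⟩ := FirstOrder.cm_iterate hz hind hV hk hk0 hhz n hv
  set u := (cm h)^[n] (1 + v * z)
  set w := (tau h)^[n] (v * z)
  have hmem : ∀ x ∈ V, x * z ∈ spanGE V z 1 := fun x hx => by
    have := smul_mem_of_mem hx (pow_mem_spanGE (V := V) (z := z) (le_refl 1))
    rwa [pow_one] at this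
  have hbV := Normalizes.of_mem hb hb0
  set c := b * (z * b⁻¹ * z⁻¹)
  have hc : c ∈ V := mul_mem hb (hz.conj _ (inv_mem hb))
  have hc0 : c ≠ 0 := mul_ne_zero hb0 (mul_ne_zero (mul_ne_zero hz.ne (inv_ne_zero hb0))
    (inv_ne_zero hz.ne))
  have hbz : b * z * b⁻¹ = c * z := by simp only [c, mul_assoc, inv_mul_cancel₀ hz.ne, mul_one]
  have h1 : b * z * b⁻¹ ∈ spanGE V z 1 := hbz ▸ hmem c hc
  have hw1 : w ∈ spanGE V z 1 := hxe ▸ hmem x hx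
  have hw2 := conj_mem_spanGE hz hbV h1 hw1
  have hconj := hF.conj hz hbV h1 (conj_inv_mem_spanGE hbV hc hc0 hbz)
  have hψ := hF.mul hz hind (hconj.inv hz hw2) hw1 (Submodule.neg_mem _ hw2)
  have hψV : u * (b * u * b⁻¹)⁻¹ ∈ V := by
    have := mul_mem (hu.conj b hb) (inv_mem hb)
    convert this using 1
    simp [mul_assoc]
  have h4 := FirstOrder.eq_one_of_mem hz hind hψV
    (Submodule.add_mem _ hw1 (Submodule.neg_mem _ hw2)) hψ
  rw [h4] at hψ
  have h5 : w + -(b * w * b⁻¹) = (x - b * x * b⁻¹ * c) * z := by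
    rw [hxe, sub_mul, mul_assoc _ c, ← hbz, sub_eq_add_neg]
    simp only [mul_assoc, inv_mul_cancel_left₀ hb0]
  rw [h5] at hψ
  have h6 := FirstOrder.eq_zero_of_one hz hind
    (sub_mem hx (mul_mem (mul_mem (mul_mem hb hx) (inv_mem hb)) hc)) hψ
  rw [h6, zero_mul, ← sub_eq_add_neg, sub_eq_zero] at h5
  exact (conj_eq_self_iff hb0).1 h5.symm

end FirstOrder

/-! ### Subnormal subgroups -/

/-- `SubnormalOfDepth n G`: there is a chain `G = G₀ ≤ G₁ ≤ ⋯ ≤ Gₙ = ⊤` with each term normal in the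
next. -/
def SubnormalOfDepth {Γ : Type*} [Group Γ] : ℕ → Subgroup Γ → Prop
  | 0, G => G = ⊤
  | n + 1, G => ∃ H, SubnormalOfDepth n H ∧ G ≤ H ∧ ∀ h ∈ H, ∀ g ∈ G, h * g * h⁻¹ ∈ G

lemma SubnormalOfDepth.comap {Γ Δ : Type*} [Group Γ] [Group Δ] (f : Δ →* Γ) {n : ℕ} :
    ∀ {G : Subgroup Γ}, SubnormalOfDepth n G → SubnormalOfDepth n (G.comap f) := by
  induction n with
  | zero =>
    rintro G rfl
    exact Subgroup.comap_top f
  | succ n ih =>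
    rintro G ⟨H, hH, hle, hn⟩
    refine ⟨H.comap f, ih hH, Subgroup.comap_mono hle, fun h hh g hg => ?_⟩
    simpa using hn (f h) hh (f g) hg

section Elements

variable {D : Type*} [DivisionRing D]

/-- The underlying subset of `D` of a subgroup of `Dˣ`. -/
def elts (G : Subgroup Dˣ) : Set D := {x | ∃ u ∈ G, (u : D) = x}

variable {G : Subgroup Dˣ}

lemma ne_zero_of_mem {x : D} (hx : x ∈ elts G) : x ≠ 0 := by
  obtain ⟨u, _, rfl⟩ := hx
  exact u.ne_zero

lemma mul_mem_elts {x y : D} (hx : x ∈ elts G) (hy : y ∈ elts G) : x * y ∈ elts G := by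
  obtain ⟨u, hu, rfl⟩ := hx
  obtain ⟨v, hv, rfl⟩ := hy
  exact ⟨u * v, mul_mem hu hv, by simp⟩

lemma inv_mem_elts {x : D} (hx : x ∈ elts G) : x⁻¹ ∈ elts G := by
  obtain ⟨u, hu, rfl⟩ := hx
  exact ⟨u⁻¹, inv_mem hu, by simp⟩

lemma mem_elts_top {x : D} (hx : x ≠ 0) : x ∈ elts (⊤ : Subgroup Dˣ) :=
  ⟨Units.mk0 x hx, trivial, rfl⟩

lemma elts_mono {H : Subgroup Dˣ} (h : G ≤ H) : elts G ⊆ elts H :=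
  fun _ ⟨u, hu, e⟩ => ⟨u, h hu, e⟩

lemma conj_mem_elts {H : Subgroup Dˣ} (h : ∀ h ∈ H, ∀ g ∈ G, h * g * h⁻¹ ∈ G) {x y : D}
    (hx : x ∈ elts H) (hy : y ∈ elts G) : x * y * x⁻¹ ∈ elts G := by
  obtain ⟨u, hu, rfl⟩ := hx
  obtain ⟨v, hv, rfl⟩ := hy
  exact ⟨_, h u hu v hv, by simp⟩

lemma cm_ne_zero {a y : D} (ha : a ≠ 0) (hy : y ≠ 0) : cm a y ≠ 0 :=
  mul_ne_zero (mul_ne_zero (mul_ne_zero ha hy) (inv_ne_zero ha)) (inv_ne_zero hy)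

lemma cm_iterate_ne_zero {a y : D} (ha : a ≠ 0) (hy : y ≠ 0) (n : ℕ) : (cm a)^[n] y ≠ 0 := by
  induction n with
  | zero => exact hy
  | succ n ih => rw [Function.iterate_succ_apply']; exact cm_ne_zero ha ih

lemma cm_mem_elts {H : Subgroup Dˣ} (h : ∀ h ∈ H, ∀ g ∈ G, h * g * h⁻¹ ∈ G) {a y : D}
    (ha : a ∈ elts G) (hy : y ∈ elts H) : cm a y ∈ elts G := by
  have := mul_mem_elts ha (conj_mem_elts h hy (inv_mem_elts ha))
  simpa [cm, mul_assoc] using this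

/-- Iterated commutators descend a subnormal chain. -/
lemma SubnormalOfDepth.cm_iterate_mem {n : ℕ} {a y : D} (hy : y ≠ 0) :
    ∀ {G : Subgroup Dˣ}, SubnormalOfDepth n G → a ∈ elts G → (cm a)^[n] y ∈ elts G := by
  induction n with
  | zero =>
    rintro G rfl _
    exact mem_elts_top hy
  | succ n ih =>
    rintro G ⟨H, hH, hle, hn⟩ ha
    rw [Function.iterate_succ_apply']
    exact cm_mem_elts hn ha (ih hH (elts_mono hle ha))

/-- The intersection of a subgroup of `Dˣ` with a division subring `E`, as a subgroup of `Eˣ`. -/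
def restrict (G : Subgroup Dˣ) (E : Subfield D) : Subgroup Eˣ :=
  G.comap (Units.map (E.subtype : E →* D))

lemma mem_elts_restrict {E : Subfield D} {x : E} : x ∈ elts (restrict G E) ↔ (x : D) ∈ elts G := by
  constructor
  · rintro ⟨u, hu, rfl⟩
    exact ⟨_, hu, rfl⟩
  · rintro ⟨u, hu, he⟩
    have hx0 : x ≠ 0 := by
      rintro rfl
      exact u.ne_zero (by simp at he)
    refine ⟨Units.mk0 x hx0, ?_, rfl⟩
    have : Units.map (E.subtype : E →* D) (Units.mk0 x hx0) = u := Units.ext he.symm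
    rw [restrict, Subgroup.mem_comap, this]
    exact hu

lemma SubnormalOfDepth.restrict {n : ℕ} (h : SubnormalOfDepth n G) (E : Subfield D) :
    SubnormalOfDepth n (restrict G E) := h.comap _

/-- `K` is invariant under conjugation by `G`. -/
def Invariant (G : Subgroup Dˣ) (K : Subfield D) : Prop := ∀ g ∈ elts G, Normalizes g K

lemma invariant_of_conj {K : Subfield D} (h : ∀ g ∈ elts G, ∀ x ∈ K, g * x * g⁻¹ ∈ K) :
    Invariant G K := fun g hg =>
  ⟨ne_zero_of_mem hg, h g hg, fun x hx => by simpa using h g⁻¹ (inv_mem_elts hg) x hx⟩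

lemma Invariant.cent {K : Subfield D} (h : Invariant G K) :
    Invariant G (AlmostSubnormal.cent (K : Set D)) := fun g hg => (h g hg).cent_subfield

lemma Invariant.inf_cent {V : Subfield D} (hV : Invariant G V) : 
    Invariant G (V ⊓ AlmostSubnormal.cent (V : Set D)) := fun g hg =>
  ⟨(hV g hg).ne, fun x hx => ⟨(hV g hg).conj x hx.1, (hV g hg).cent_subfield.conj x hx.2⟩,
    fun x hx => ⟨(hV g hg).conj_inv x hx.1, (hV g hg).cent_subfield.conj_inv x hx.2⟩⟩

lemma inf_cent_comm (V : Subfield D) : ∀ x ∈ V ⊓ cent (V : Set D), ∀ y ∈ V ⊓ cent (V : Set D),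
    x * y = y * x := fun x hx _ hy => mem_cent.1 hy.2 x hx.1

lemma normalizes_comap {K E : Subfield D} {g : E} (h : Normalizes (g : D) K) :
    Normalizes g (K.comap E.subtype) :=
  ⟨fun h0 => h.ne (by simp [h0]), fun x hx => h.conj x hx, fun x hx => h.conj_inv x hx⟩

lemma Invariant.restrict {K : Subfield D} (h : Invariant G K) (E : Subfield D) :
    Invariant (restrict G E) (K.comap E.subtype) :=
  fun g hg => normalizes_comap (h g (mem_elts_restrict.1 hg))

lemma closure_conj_mem {S : Set D} {h : D} (h0 : h ≠ 0)
    (hS : ∀ s ∈ S, h * s * h⁻¹ ∈ Subfield.closure S) {x : D}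
    (hx : x ∈ Subfield.closure S) : h * x * h⁻¹ ∈ Subfield.closure S := by
  induction hx using Subfield.closure_induction with
  | mem x hx => exact hS x hx
  | one => simp [h0]
  | add x y _ _ hx hy => rw [mul_add, add_mul]; exact add_mem hx hy
  | neg x _ hx => rw [mul_neg, neg_mul]; exact neg_mem hx
  | inv x _ hx => simpa [mul_assoc] using inv_mem hx
  | mul x y _ _ hx hy => simpa [mul_assoc, inv_mul_cancel_left₀ h0] using mul_mem hx hy

lemma closure_comm {S : Set D} (hS : ∀ x ∈ S, ∀ y ∈ S, x * y = y * x) :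
    ∀ x ∈ Subfield.closure S, ∀ y ∈ Subfield.closure S, x * y = y * x := by
  have : Subfield.closure S ≤ AlmostSubnormal.cent (AlmostSubnormal.cent S : Set D) :=
    Subfield.closure_le.2 fun x hx => mem_cent_cent hx
  intro x hx y hy
  exact cent_cent_comm hS x (this hx) y (this hy)

lemma closure_le_cent {S T : Set D} (h : ∀ x ∈ S, ∀ y ∈ T, y * x = x * y) :
    Subfield.closure S ≤ AlmostSubnormal.cent T :=
  Subfield.closure_le.2 fun x hx => mem_cent.2 (h x hx)

/-! ### Nilpotent differences -/

lemma tau_eq_zero_iff {a x : D} (ha : a ≠ 0) : tau a x = 0 ↔ a * x = x * a := by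
  rw [tau, sub_eq_zero, conj_eq_self_iff ha]

lemma tau_mem {V : Subfield D} {a x : D} (ha : a ∈ V) (hx : x ∈ V) : tau a x ∈ V :=
  sub_mem (mul_mem (mul_mem ha hx) (inv_mem ha)) hx

lemma tau_iterate_mem {V : Subfield D} {a x : D} (ha : a ∈ V) (hx : x ∈ V) (n : ℕ) :
    (tau a)^[n] x ∈ V := by
  induction n with
  | zero => exact hx
  | succ n ih => rw [Function.iterate_succ_apply']; exact tau_mem ha ih

lemma tau_zero (a : D) : tau a 0 = 0 := by simp [tau]

lemma tau_iterate_mul {a e : D} (he : a * e = e * a) (n : ℕ) (x : D) :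
    (tau a)^[n] (x * e) = (tau a)^[n] x * e := by
  induction n with
  | zero => rfl
  | succ n ih =>
    rw [Function.iterate_succ_apply', ih, Function.iterate_succ_apply', tau, tau, sub_mul]
    have : e * a⁻¹ = a⁻¹ * e := (show Commute a e from he).inv_left₀.eq.symm
    simp only [mul_assoc, this]

/-- The last nonzero term of a terminating sequence of differences. -/
lemma exists_last_tau {a k : D} {N : ℕ} (hN : (tau a)^[N] k = 0) (hk : k ≠ 0) :
    ∃ j, (tau a)^[j] k ≠ 0 ∧ (tau a)^[j + 1] k = 0 := by
  classical
  have hex : ∃ m, (tau a)^[m] k = 0 := ⟨N, hN⟩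
  obtain ⟨j, hj⟩ := Nat.exists_eq_succ_of_ne_zero
    (show Nat.find hex ≠ 0 from fun h => hk (by simpa [h] using Nat.find_spec hex))
  exact ⟨j, Nat.find_min hex (by omega), by simpa [hj] using Nat.find_spec hex⟩

/-- A nontrivial unipotent inner automorphism translates some element by `1`. -/
lemma exists_conj_eq_add_one {V : Subfield D} {a k : D} (haV : a ∈ V) (ha : a ≠ 0) (hk : k ∈ V)
    {N : ℕ} (hN : (tau a)^[N] k = 0) (hne : a * k ≠ k * a) : ∃ v ∈ V, a * v * a⁻¹ = v + 1 := by
  obtain ⟨j, hj, hj1⟩ := exists_last_tau (a := a) (k := tau a k) (N := N)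
    (by rw [← Function.iterate_succ_apply (tau a), Function.iterate_succ_apply', hN, tau_zero])
    (fun h => hne ((tau_eq_zero_iff ha).1 h))
  set e := (tau a)^[j] (tau a k) with he
  set w := (tau a)^[j] k with hw
  have hwe : a * w * a⁻¹ = w + e := by
    have : tau a w = e := by
      rw [hw, he, ← Function.iterate_succ_apply' (tau a), Function.iterate_succ_apply]
    rw [← this, tau]
    abel
  have hee : a * e * a⁻¹ = e := by
    rw [conj_eq_self_iff ha, ← tau_eq_zero_iff ha, ← hj1, Function.iterate_succ_apply']
  refine ⟨e⁻¹ * w, mul_mem (inv_mem (tau_iterate_mem haV (tau_mem haV hk) j))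
    (tau_iterate_mem haV hk j), ?_⟩
  calc a * (e⁻¹ * w) * a⁻¹ = (a * e * a⁻¹)⁻¹ * (a * w * a⁻¹) := by
        simp [mul_assoc, inv_mul_cancel_left₀ ha]
    _ = e⁻¹ * w + 1 := by rw [hee, hwe, mul_add, inv_mul_cancel₀ hj]

lemma pow_conj_eq_add {a v : D} (ha : a ≠ 0) (h : a * v * a⁻¹ = v + 1) (n : ℕ) :
    a ^ n * v * (a ^ n)⁻¹ = v + n := by
  induction n with
  | zero => simp
  | succ n ih =>
    have : a ^ (n + 1) * v * (a ^ (n + 1))⁻¹ = a * (a ^ n * v * (a ^ n)⁻¹) * a⁻¹ := by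
      simp [pow_succ', mul_assoc]
    rw [this, ih, mul_add, add_mul, h, (Nat.cast_commute n a).eq.symm, mul_assoc (n : D),
      mul_inv_cancel₀ ha]
    push_cast
    rw [mul_one, add_assoc, add_comm (1 : D)]

lemma cm_mem_of_normalizes {P : Subfield D} {a y : D} (ha : Normalizes a P) (hy : y ∈ P) :
    cm a y ∈ P := mul_mem (ha.conj y hy) (inv_mem hy)

lemma cm_iterate_mem_of_normalizes {P : Subfield D} {a y : D} (ha : Normalizes a P) (hy : y ∈ P)
    (n : ℕ) : (cm a)^[n] y ∈ P := by
  induction n with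
  | zero => exact hy
  | succ n ih => rw [Function.iterate_succ_apply']; exact cm_mem_of_normalizes ha ih

lemma cm_eq_one_iff {a y : D} (ha : a ≠ 0) (hy : y ≠ 0) : cm a y = 1 ↔ a * y = y * a := by
  rw [cm, mul_inv_eq_one₀ hy, conj_eq_self_iff ha]

/-- A group `G ∩ V` of elements of `V`, closed under iterated commutators with `V`, whose elements
all act unipotently on `V`, is central in `V`. Otherwise some `a` translates some `v` by `1`; the
elements `g = (cm a)^[n] (v + t)` of `G`, with `t` fixed by `a`, act on `a` by multiplication with
`g (a g a⁻¹)⁻¹`, so unipotency forces `a` to commute with `g`. -/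
theorem commute_of_tau_nilpotent {V : Subfield D} {n N : ℕ}
    (hcm : ∀ a ∈ elts G, a ∈ V → ∀ y ∈ V, y ≠ 0 → (cm a)^[n] y ∈ elts G)
    (hnil : ∀ a ∈ elts G, a ∈ V → ∀ k ∈ V, (tau a)^[N] k = 0) {a k : D} (ha : a ∈ elts G)
    (haV : a ∈ V) (hk : k ∈ V) : a * k = k * a := by
  by_contra hne
  have ha0 := ne_zero_of_mem ha
  obtain ⟨v, hv, hav⟩ := exists_conj_eq_add_one haV ha0 hk (hnil a ha haV k hk) hne
  set p := ringChar D with hp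
  have hap : a ^ p * v = v * a ^ p := by
    have := pow_conj_eq_add ha0 hav p
    rw [hp, ringChar.Nat.cast_ringChar, add_zero, conj_eq_self_iff (pow_ne_zero _ ha0)] at this
    exact this
  let S : Set D := {s | s = a ^ p ∨ ∃ i : ℤ, s = v + i}
  have hScomm : ∀ x ∈ S, ∀ y ∈ S, x * y = y * x := by
    have h1 : ∀ i : ℤ, a ^ p * (v + i) = (v + i) * a ^ p := fun i => by
      rw [mul_add, add_mul, hap, (Int.cast_commute i (a ^ p)).eq]
    have h2 : ∀ i j : ℤ, (v + i) * (v + j) = (v + j) * (v + i) := fun i j =>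
      (((Commute.refl v).add_right (Int.cast_commute j v).symm).add_left
        ((Int.cast_commute i v).add_right (Int.cast_commute i _))).eq
    rintro x (rfl | ⟨i, rfl⟩) y (rfl | ⟨j, rfl⟩)
    exacts [rfl, h1 j, (h1 i).symm, h2 i j]
  have hav' : ∀ i : ℤ, a * (v + i) * a⁻¹ = v + (i + 1 : ℤ) := fun i => by
    rw [mul_add, add_mul, hav, (Int.cast_commute i a).eq.symm, mul_assoc (i : D),
      mul_inv_cancel₀ ha0]
    push_cast
    rw [mul_one, add_assoc, add_comm (1 : D)]
  have hS1 : ∀ s ∈ S, a * s * a⁻¹ ∈ S := by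
    rintro s (rfl | ⟨i, rfl⟩)
    · left
      rw [← pow_succ', pow_succ, mul_inv_cancel_right₀ ha0]
    · exact Or.inr ⟨i + 1, hav' i⟩
  have hS2 : ∀ s ∈ S, a⁻¹ * s * a ∈ S := by
    rintro s (rfl | ⟨i, rfl⟩)
    · left
      rw [mul_assoc, ← pow_succ, pow_succ', inv_mul_cancel_left₀ ha0]
    · right
      refine ⟨i - 1, ?_⟩
      have := hav' (i - 1)
      rw [sub_add_cancel] at this
      rw [← this]
      simp only [mul_assoc, inv_mul_cancel_left₀ ha0, inv_mul_cancel₀ ha0, mul_one]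
  have haC : Normalizes a (AlmostSubnormal.cent (AlmostSubnormal.cent S : Set D)) :=
    (Normalizes.cent ha0 hS1 hS2).cent_subfield
  let P : Subfield D := AlmostSubnormal.cent (AlmostSubnormal.cent S : Set D) ⊓ V
  have haVn := Normalizes.of_mem haV ha0
  have haP : Normalizes a P :=
    ⟨ha0, fun x hx => ⟨haC.conj x hx.1, haVn.conj x hx.2⟩,
      fun x hx => ⟨haC.conj_inv x hx.1, haVn.conj_inv x hx.2⟩⟩
  have hPcomm : ∀ x ∈ P, ∀ y ∈ P, x * y = y * x := fun x hx y hy =>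
    cent_cent_comm hScomm x hx.1 y hy.1
  have hvP : v ∈ P := ⟨mem_cent_cent (Or.inr ⟨0, by simp⟩), hv⟩
  have hapP : a ^ p ∈ P := ⟨mem_cent_cent (Or.inl rfl), pow_mem haV p⟩
  have hcontra : a * v ≠ v * a := fun h => by
    rw [(conj_eq_self_iff ha0).2 h] at hav
    exact one_ne_zero (left_eq_add.1 hav)
  by_cases hfin : {t | t ∈ P ∧ a * t = t * a}.Finite
  · rcases Nat.eq_zero_or_pos p with hp0 | hp0
    · have : CharZero D := (CharP.ringChar_zero_iff_CharZero D).1 hp0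
      refine (Set.infinite_of_injective_forall_mem (Nat.cast_injective (R := D)) fun i => ?_) hfin
      exact ⟨natCast_mem P i, (Nat.cast_commute i a).eq.symm⟩
    · exact hcontra (comm_of_fixed_finite P hPcomm haP hp0 hapP hfin hvP)
  · refine hcontra (comm_of_cm_iterate P hPcomm haP hfin hvP (n + 1) fun t htP hat h0 => ?_)
    have hyP : v + t ∈ P := add_mem hvP htP
    set g := (cm a)^[n] (v + t) with hg
    have hgG : g ∈ elts G := hcm a ha haV _ hyP.2 h0
    have hgP : g ∈ P := cm_iterate_mem_of_normalizes haP hyP n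
    have hg0 := ne_zero_of_mem hgG
    set c := g * (a * g * a⁻¹)⁻¹ with hc
    have hcP : c ∈ P := mul_mem hgP (inv_mem (haP.conj g hgP))
    have hgac : g * a * g⁻¹ = c * a := by
      simp [hc, mul_assoc, inv_mul_cancel₀ ha0]
    have hpow : ∀ i : ℕ, (tau g)^[i] a = (c - 1) ^ i * a := fun i => by
      induction i with
      | zero => simp
      | succ i ih =>
        have hcomm : g * (c - 1) ^ i = (c - 1) ^ i * g :=
          hPcomm _ hgP _ (pow_mem (sub_mem hcP (one_mem P)) i)
        rw [Function.iterate_succ_apply', ih, tau, ← mul_assoc, hcomm, mul_assoc, mul_assoc,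
          ← mul_assoc g, hgac, pow_succ]
        noncomm_ring
    have hc1 : (c - 1) ^ N = 0 := by
      have := hnil g hgG hgP.2 a haV
      rw [hpow] at this
      exact (mul_eq_zero.1 this).resolve_right ha0
    have hc1' : c = 1 := sub_eq_zero.1 (eq_zero_of_pow_eq_zero hc1)
    rw [Function.iterate_succ_apply', ← hg, cm_eq_one_iff ha0 hg0, ← conj_eq_self_iff ha0]
    rw [hc, mul_inv_eq_one₀ (mul_ne_zero (mul_ne_zero ha0 hg0) (inv_ne_zero ha0))] at hc1'
    exact hc1'.symm

end Elements

/-! ### Independence of the powers of a normalizing element -/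

section Independence

variable {D : Type*} [DivisionRing D] {V : Subfield D} {z : D}

lemma linearIndepOn_pow {r : ℕ} (h : ∀ m < r, z ^ m ∉ spanLT V z m) :
    LinearIndepOn V (fun i : ℕ => z ^ i) (Set.Iio r) := by
  induction r with
  | zero => simp
  | succ r ih =>
    have : Set.Iio (r + 1) = insert r (Set.Iio r) := by
      ext i
      simp
    rw [this]
    refine (ih fun m hm => h m (by omega)).insert ?_
    have himage : (fun i => z ^ i) '' Set.Iio r = {x | ∃ i < r, x = z ^ i} := by
      ext y
      simp [eq_comm]
    rw [himage]
    exact h r r.lt_succ_self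

lemma exists_pow_mem_spanLT (h : ¬ LinearIndependent V fun i : ℕ => z ^ i) :
    ∃ r, z ^ r ∈ spanLT V z r ∧ ∀ m < r, z ^ m ∉ spanLT V z m := by
  classical
  have hex : ∃ r, z ^ r ∈ spanLT V z r := by
    by_contra! hne
    refine h (linearIndependent_iff'.2 fun s g hg i hi => ?_)
    obtain ⟨r, hr⟩ : ∃ r, ∀ i ∈ s, i < r := ⟨s.sup id + 1, fun i hi =>
      Nat.lt_succ_of_le (Finset.le_sup (f := id) hi)⟩
    exact linearIndepOn_finset_iff.1
      ((linearIndepOn_pow (r := r) fun m _ => hne m).mono fun i hi => hr i hi) g hg i hi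
  exact ⟨Nat.find hex, Nat.find_spec hex, fun m hm => Nat.find_min hex hm⟩

/-- Below the degree of a minimal relation the coefficients are unique. -/
lemma coeff_unique {r : ℕ} (h : ∀ m < r, z ^ m ∉ spanLT V z m) {c d : Fin r → D}
    (hc : ∀ i, c i ∈ V) (hd : ∀ i, d i ∈ V)
    (he : ∑ i, c i * z ^ (i : ℕ) = ∑ i, d i * z ^ (i : ℕ)) : c = d := by
  have hli : LinearIndependent V fun i : Fin r => z ^ (i : ℕ) :=
    (linearIndepOn_pow h).comp (fun i : Fin r => ⟨i, i.2⟩) fun i j hij =>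
      Fin.ext (congrArg Subtype.val hij)
  funext i
  have := Fintype.linearIndependent_iff.1 hli
    (fun i => ⟨c i - d i, sub_mem (hc i) (hd i)⟩) ?_ i
  · exact sub_eq_zero.1 (congrArg Subtype.val this)
  · simpa [Subfield.smul_def, sub_mul, sub_eq_zero] using he

/-- Comparison of coefficients in `w b = β w`. -/
lemma coeff_mul_eq {r : ℕ} (hz : Normalizes z V) (h : ∀ m < r, z ^ m ∉ spanLT V z m)
    {c : Fin r → D} (hc : ∀ i, c i ∈ V) {b β : D} (hb : b ∈ V) (hβ : β ∈ V)
    (he : (∑ i, c i * z ^ (i : ℕ)) * b = β * ∑ i, c i * z ^ (i : ℕ)) (i : Fin r) :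
    c i * z ^ (i : ℕ) * b = β * (c i * z ^ (i : ℕ)) := by
  have hconj : ∀ j : Fin r, c j * (z ^ (j : ℕ) * b * (z ^ (j : ℕ))⁻¹) ∈ V := fun j =>
    mul_mem (hc j) ((hz.pow j).conj b hb)
  have hcan : ∀ j : Fin r, c j * (z ^ (j : ℕ) * b * (z ^ (j : ℕ))⁻¹) * z ^ (j : ℕ) =
      c j * z ^ (j : ℕ) * b := fun j => by
    rw [← mul_assoc, ← mul_assoc, inv_mul_cancel_right₀ (pow_ne_zero _ hz.ne)]
  have := coeff_unique h hconj (fun j => mul_mem hβ (hc j)) (by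
    simp only [hcan, mul_assoc β]
    rw [← Finset.sum_mul, ← Finset.mul_sum, he])
  rw [← hcan, congrFun this i, mul_assoc]

lemma spanLT_zero : spanLT V z 0 = ⊥ := by simp [spanLT]

/-- A minimal relation provides a power of `z` which acts on `V` as an element of `V` does. -/
lemma exists_mul_pow_commute (hz : Normalizes z V)
    (h : ¬ LinearIndependent V fun i : ℕ => z ^ i) :
    ∃ r > 0, ∃ k ∈ V, k ≠ 0 ∧ ∀ b ∈ V, k * z ^ r * b = b * (k * z ^ r) := by
  obtain ⟨r, hr, hmin⟩ := exists_pow_mem_spanLT h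
  obtain ⟨r, rfl⟩ : ∃ s, r = s + 1 := by
    refine Nat.exists_eq_succ_of_ne_zero ?_
    rintro rfl
    simp [spanLT_zero] at hr
  obtain ⟨c, hc⟩ := mem_spanLT_iff.1 hr
  -- the constant coefficient of a minimal relation does not vanish
  have hc0 : (c 0 : D) ≠ 0 := by
    intro h0
    refine hmin r r.lt_succ_self (mem_spanLT_iff.2
      ⟨fun i => ⟨z⁻¹ * c i.succ * z, hz.conj_inv _ (c i.succ).2⟩, ?_⟩)
    rw [Fin.sum_univ_succ, h0, zero_mul, zero_add] at hc
    refine mul_left_cancel₀ hz.ne ?_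
    rw [← pow_succ', ← hc, Finset.mul_sum]
    refine Finset.sum_congr rfl fun i _ => ?_
    simp [pow_succ', mul_assoc, hz.ne]
  refine ⟨r + 1, r.succ_pos, (c 0 : D)⁻¹, inv_mem (c 0).2, inv_ne_zero hc0, fun b hb => ?_⟩
  set x := z ^ (r + 1) with hx
  have hx0 : x ≠ 0 := pow_ne_zero _ hz.ne
  have hβ := (hz.pow (r + 1)).conj b hb
  have := coeff_mul_eq hz hmin (fun i => (c i).2) hb hβ (by
    rw [hc, ← hx, inv_mul_cancel_right₀ hx0]) 0
  rw [Fin.val_zero, pow_zero, mul_one, ← hx] at this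
  rw [← mul_right_inj' hc0]
  calc (c 0 : D) * ((c 0 : D)⁻¹ * x * b) = x * b := by
        rw [mul_assoc, mul_inv_cancel_left₀ hc0]
    _ = x * b * x⁻¹ * (c 0 * ((c 0 : D)⁻¹ * x)) := by
        rw [mul_inv_cancel_left₀ hc0, inv_mul_cancel_right₀ hx0]
    _ = c 0 * (b * ((c 0 : D)⁻¹ * x)) := by rw [← mul_assoc, ← this, mul_assoc]

/-- If `z` centralizes `V` then the coefficients of a minimal relation are central in `V`. -/
lemma exists_pow_mem_spanLT_of_comm (hz0 : z ≠ 0) (hz : ∀ b ∈ V, z * b = b * z)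
    (h : ¬ LinearIndependent V fun i : ℕ => z ^ i) {W : Subfield D}
    (hW : ∀ x ∈ V, (∀ b ∈ V, x * b = b * x) → x ∈ W) : ∃ r, z ^ r ∈ spanLT W z r := by
  obtain ⟨r, hr, hmin⟩ := exists_pow_mem_spanLT h
  obtain ⟨c, hc⟩ := mem_spanLT_iff.1 hr
  have hpow : ∀ (i : ℕ), ∀ b ∈ V, z ^ i * b = b * z ^ i := fun i b hb =>
    (show Commute z b from hz b hb).pow_left i
  refine ⟨r, mem_spanLT_iff.2 ⟨fun i => ⟨c i, hW _ (c i).2 fun b hb => ?_⟩, hc⟩⟩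
  have := coeff_mul_eq (Normalizes.of_comm hz0 hz) hmin (fun i => (c i).2) hb hb
    (by rw [hc, hpow r b hb]) i
  rw [mul_assoc, hpow i b hb, ← mul_assoc, ← mul_assoc] at this
  exact mul_right_cancel₀ (pow_ne_zero _ hz0) this

variable {G : Subgroup Dˣ} {n : ℕ}

lemma one_add_mul_ne_zero (hz : Normalizes z V) (hind : LinearIndependent V fun i : ℕ => z ^ i)
    {v : D} (hv : v ∈ V) : 1 + v * z ≠ 0 := by
  have hw : v * z ∈ spanGE V z 1 := by
    have := smul_mem_of_mem hv (pow_mem_spanGE (V := V) (z := z) (le_refl 1))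
    rwa [pow_one] at this
  exact (FirstOrder.one_add hind hw).ne_zero hz hw

lemma conj_eq_cm_mul {a z : D} (hz : z ≠ 0) : a * z * a⁻¹ = cm a z * z := by
  rw [cm, inv_mul_cancel_right₀ hz]

lemma cm_mem_of_mem {a z : D} (haV : a ∈ V) (hz : Normalizes z V) : cm a z ∈ V := by
  have := mul_mem haV (hz.conj _ (inv_mem haV))
  simpa only [cm, mul_assoc] using this

/-- For `a ∈ G ∩ V` the `n`-th difference of `v z` commutes with `V`, in particular with `a`. -/
lemma tau_iterate_mul_eq_zero (hG : SubnormalOfDepth n G) (hV : Invariant G V)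
    (hz : Normalizes z V) (hind : LinearIndependent V fun i : ℕ => z ^ i) {a v : D}
    (ha : a ∈ elts G) (haV : a ∈ V) (hv : v ∈ V) : (tau a)^[n + 1] (v * z) = 0 := by
  have ha0 := ne_zero_of_mem ha
  rw [Function.iterate_succ_apply', tau_eq_zero_iff ha0]
  exact commute_tau_iterate hz hind (hV a ha) (cm_mem_of_mem haV hz)
    (cm_ne_zero ha0 hz.ne) (conj_eq_cm_mul hz.ne) n hv
    (hV _ (hG.cm_iterate_mem (one_add_mul_ne_zero hz hind hv) ha)) a haV

lemma exists_commute_mul (hG : SubnormalOfDepth n G) (hV : Invariant G V)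
    (hz : Normalizes z V) (hind : LinearIndependent V fun i : ℕ => z ^ i) {a : D}
    (ha : a ∈ elts G) (haV : a ∈ V) : ∃ k ∈ V, k ≠ 0 ∧ a * (k * z) = k * z * a := by
  have ha0 := ne_zero_of_mem ha
  have h1 := tau_iterate_mul_eq_zero hG hV hz hind ha haV (one_mem V)
  obtain ⟨j, hj, hj1⟩ := exists_last_tau h1 (by simpa using hz.ne)
  obtain ⟨_, x, hx, hxe⟩ := FirstOrder.cm_iterate hz hind (hV a ha) (cm_mem_of_mem haV hz)
    (cm_ne_zero ha0 hz.ne) (conj_eq_cm_mul hz.ne) j (one_mem V)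
  rw [Function.iterate_succ_apply', tau_eq_zero_iff ha0] at hj1
  rw [hxe] at hj hj1
  exact ⟨x, hx, left_ne_zero_of_mul hj, hj1⟩

/-- If some normalizing element of an invariant division subring `V` has independent powers over
`V` then `G ∩ V` is central in `V`. -/
theorem commute_of_linearIndependent (hG : SubnormalOfDepth n G) (hV : Invariant G V)
    (hz : Normalizes z V) (hind : LinearIndependent V fun i : ℕ => z ^ i) {a k : D}
    (ha : a ∈ elts G) (haV : a ∈ V) (hk : k ∈ V) : a * k = k * a := by
  refine commute_of_tau_nilpotent (n := n) (N := n + 1)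
    (fun a ha _ y _ hy => hG.cm_iterate_mem hy ha) (fun a ha haV k hk => ?_) ha haV hk
  obtain ⟨k0, hk0, hne, hcomm⟩ := exists_commute_mul hG hV hz hind ha haV
  have := tau_iterate_mul_eq_zero hG hV hz hind ha haV (mul_mem hk hk0)
  rw [mul_assoc, tau_iterate_mul hcomm] at this
  exact (mul_eq_zero.1 this).resolve_right (mul_ne_zero hne hz.ne)

end Independence
/-! ### First-order expansions along an infinite center -/

section Ultrapower

open Filter

variable {D : Type*} [DivisionRing D]

/-- The ultrapower of `D` along a nonprincipal ultrafilter on `ℕ`. -/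
abbrev Ultrapower (D : Type*) : Type _ := Germ (hyperfilter ℕ : Filter ℕ) D

/-- The diagonal embedding into the ultrapower. -/
noncomputable def diag : D →+* Ultrapower D where
  toFun d := ((fun _ => d : ℕ → D) : Ultrapower D)
  map_one' := rfl
  map_zero' := rfl
  map_add' _ _ := rfl
  map_mul' _ _ := rfl

/-- The germ of a sequence of central elements. -/
noncomputable def centralGerm (lam : ℕ → Subring.center D) : Ultrapower D :=
  ((fun i => (lam i : D)) : ℕ → D)

lemma centralGerm_comm (lam : ℕ → Subring.center D) (d : D) :
    diag d * centralGerm lam = centralGerm lam * diag d :=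
  congrArg (fun f : ℕ → D => (f : Ultrapower D))
    (funext fun i => mem_center_iff.1 (lam i).2 d)

lemma centralGerm_ne_zero {lam : ℕ → Subring.center D} (hlam : Function.Injective lam) :
    centralGerm lam ≠ 0 := by
  intro h
  have h' : ∀ᶠ i in (hyperfilter ℕ : Filter ℕ), (lam i : D) = 0 := Germ.coe_eq.1 h
  have hfin : {i | (lam i : D) = 0}.Finite :=
    Set.Subsingleton.finite fun i hi j hj => hlam (Subtype.ext (hi.trans hj.symm))
  exact notMem_hyperfilter_of_finite hfin h'

lemma normalizes_centralGerm {lam : ℕ → Subring.center D} (hlam : Function.Injective lam) :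
    Normalizes (centralGerm lam) (diag (D := D)).fieldRange :=
  Normalizes.of_comm (centralGerm_ne_zero hlam) (by
    rintro _ ⟨d, rfl⟩
    exact (centralGerm_comm lam d).symm)

/-- The center of a division ring, as a field. -/
abbrev centerField (D : Type*) [DivisionRing D] : Field (Subring.center D) :=
  { (inferInstance : DivisionRing (Subring.center D)),
    (inferInstance : CommRing (Subring.center D)) with }

open Polynomial in
/-- A polynomial expression with infinitely many central zeros vanishes. -/
lemma eq_zero_of_infinite_central {s : Finset ℕ} {d : ℕ → D} {A : Set (Subring.center D)}
    (hA : A.Infinite) (h : ∀ t ∈ A, ∑ i ∈ s, d i * (t : D) ^ i = 0) : ∀ i ∈ s, d i = 0 := by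
  let := centerField D
  intro i hi
  refine (Module.forall_dual_apply_eq_zero_iff (Subring.center D) (d i)).1 fun φ => ?_
  have hp : (∑ j ∈ s, monomial j (φ (d j)) : (Subring.center D)[X]) = 0 := by
    refine eq_zero_of_infinite_isRoot _ (hA.mono fun t ht => ?_)
    have := congrArg φ (h t ht)
    rw [map_sum, map_zero] at this
    rw [Set.mem_ofPred_eq, IsRoot.def, eval_finsetSum, ← this]
    refine Finset.sum_congr rfl fun j _ => ?_
    have e : d j * (t : D) ^ j = t ^ j • d j := by
      rw [Subring.smul_def, smul_eq_mul, Subring.coe_pow]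
      exact mem_center_iff.1 (pow_mem t.2 j) _
    rw [e, map_smul, eval_monomial, smul_eq_mul, mul_comm]
  have := congrArg (fun q => q.coeff i) hp
  simpa [finsetSum_coeff, coeff_monomial, hi] using this

/-- The germ of a sequence of distinct central elements is transcendental over the diagonal. -/
lemma linearIndependent_centralGerm {lam : ℕ → Subring.center D} (hlam : Function.Injective lam) :
    LinearIndependent (diag (D := D)).fieldRange fun i : ℕ => centralGerm lam ^ i := by
  refine linearIndependent_iff'.2 fun s g hg => ?_
  choose d hd using fun i => (g i).2
  have e : ∑ i ∈ s, g i • centralGerm lam ^ i =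
      ((fun k => ∑ i ∈ s, d i * (lam k : D) ^ i : ℕ → D) : Ultrapower D) := by
    have h1 : (fun k => ∑ i ∈ s, d i * (lam k : D) ^ i) =
        ∑ i ∈ s, (fun k => d i * (lam k : D) ^ i) := by
      ext k
      simp
    have h2 : ∀ f : ℕ → ℕ → D, ((∑ i ∈ s, f i : ℕ → D) : Ultrapower D) =
        ∑ i ∈ s, ((f i : ℕ → D) : Ultrapower D) := fun f =>
      map_sum (Germ.coeRingHom (hyperfilter ℕ : Filter ℕ)) _ _
    rw [h1, h2]
    refine Finset.sum_congr rfl fun i _ => ?_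
    rw [Subfield.smul_def, ← hd, smul_eq_mul]
    rfl
  rw [e] at hg
  have hev : ∀ᶠ k in (hyperfilter ℕ : Filter ℕ), ∑ i ∈ s, d i * (lam k : D) ^ i = 0 :=
    Germ.coe_eq.1 hg
  have hinf : {k | ∑ i ∈ s, d i * (lam k : D) ^ i = 0}.Infinite := fun hfin =>
    notMem_hyperfilter_of_finite hfin hev
  intro i hi
  have := eq_zero_of_infinite_central (hinf.image hlam.injOn) (by
    rintro _ ⟨k, hk, rfl⟩
    exact hk) i hi
  exact Subtype.ext (by rw [← hd, this, map_zero]; rfl)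

/-- The sequence `f` has the expansion `f i = 1 + d * lam i + ⋯`: in the ultrapower, its germ has
linear term `d` times the germ of `lam`. -/
def Expansion (lam : ℕ → Subring.center D) (f : ℕ → D) (d : D) : Prop :=
  FirstOrder (diag (D := D)).fieldRange (centralGerm lam) (f : Ultrapower D)
    (diag d * centralGerm lam)

lemma diag_mul_mem (lam : ℕ → Subring.center D) (d : D) : diag d * centralGerm lam ∈
    spanGE (diag (D := D)).fieldRange (centralGerm lam) 1 := by
  have := smul_mem_of_mem (V := (diag (D := D)).fieldRange) ⟨d, rfl⟩
    (pow_mem_spanGE (V := (diag (D := D)).fieldRange) (z := centralGerm lam) (le_refl 1))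
  rwa [pow_one] at this

namespace Expansion

variable {lam : ℕ → Subring.center D} (hlam : Function.Injective lam) {f g : ℕ → D} {d e : D}

include hlam

lemma one_add (d : D) : Expansion lam (fun i => 1 + d * lam i) d :=
  FirstOrder.one_add (linearIndependent_centralGerm hlam) (diag_mul_mem lam d)

lemma mul (hf : Expansion lam f d) (hg : Expansion lam g e) :
    Expansion lam (fun i => f i * g i) (d + e) := by
  have := FirstOrder.mul (normalizes_centralGerm hlam) (linearIndependent_centralGerm hlam) hf hg
    (diag_mul_mem lam d) (diag_mul_mem lam e)
  rw [← add_mul, ← map_add] at this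
  exact this

lemma inv (hf : Expansion lam f d) : Expansion lam (fun i => (f i)⁻¹) (-d) := by
  have := FirstOrder.inv (normalizes_centralGerm hlam) hf (diag_mul_mem lam d)
  rw [← neg_mul, ← map_neg] at this
  exact this

lemma conj (hf : Expansion lam f d) {a : D} (ha : a ≠ 0) :
    Expansion lam (fun i => a * f i * a⁻¹) (a * d * a⁻¹) := by
  have ha' : diag a ≠ 0 := (map_ne_zero diag).2 ha
  have hc : ∀ b : D, diag b * centralGerm lam * (diag b)⁻¹ ∈
      spanGE (diag (D := D)).fieldRange (centralGerm lam) 1 := fun b => by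
    rw [mul_assoc, ← map_inv₀, ← centralGerm_comm, ← mul_assoc, ← map_mul]
    exact diag_mul_mem lam _
  have := FirstOrder.conj (h := diag a) (normalizes_centralGerm hlam)
    (Normalizes.of_mem ⟨a, rfl⟩ ha') (hc a) (by simpa using hc a⁻¹) hf
  have e : diag a * (diag d * centralGerm lam) * (diag a)⁻¹ =
      diag (a * d * a⁻¹) * centralGerm lam := by
    rw [map_mul, map_mul, map_inv₀]
    simp only [mul_assoc]
    rw [← map_inv₀, centralGerm_comm]
  rw [e] at this
  exact this

lemma cm (hf : Expansion lam f d) {a : D} (ha : a ≠ 0) :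
    Expansion lam (fun i => AlmostSubnormal.cm a (f i)) (tau a d) := by
  have := (hf.conj hlam ha).mul hlam (hf.inv hlam)
  rwa [← sub_eq_add_neg] at this

lemma cm_iterate (hf : Expansion lam f d) {a : D} (ha : a ≠ 0) (n : ℕ) :
    Expansion lam (fun i => (AlmostSubnormal.cm a)^[n] (f i)) ((tau a)^[n] d) := by
  induction n with
  | zero => exact hf
  | succ n ih =>
    simp only [Function.iterate_succ_apply']
    exact ih.cm hlam ha

lemma eventually_ne_zero (hf : Expansion lam f d) :
    ∀ᶠ i in (hyperfilter ℕ : Filter ℕ), f i ≠ 0 := by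
  have := FirstOrder.ne_zero (normalizes_centralGerm hlam) hf (diag_mul_mem lam d)
  exact Ultrafilter.eventually_not.2 fun h => this (Germ.coe_eq.2 h)

lemma eq_zero (hf : Expansion lam f d) (h : ∀ᶠ i in (hyperfilter ℕ : Filter ℕ), f i = 1) :
    d = 0 := by
  have h1 : (f : Ultrapower D) = 1 := Germ.coe_eq.2 h
  rw [Expansion, h1] at hf
  have := FirstOrder.eq_zero_of_one (normalizes_centralGerm hlam)
    (linearIndependent_centralGerm hlam) ⟨d, rfl⟩ hf
  exact (map_eq_zero diag).1 this

end Expansion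

variable [Infinite (Subring.center D)]

lemma tau_iterate_eq_zero_of_cm {a : D} (ha : a ≠ 0) {N : ℕ}
    (h : ∀ y, y ≠ 0 → (cm a)^[N] y = 1) (v : D) : (tau a)^[N] v = 0 := by
  have hlam := (Infinite.natEmbedding (Subring.center D)).injective
  have h0 := Expansion.one_add hlam v
  exact (h0.cm_iterate hlam ha N).eq_zero hlam
    ((h0.eventually_ne_zero hlam).mono fun i hi => h _ hi)

/-- If iterated commutators `u` of `a ∈ V` normalize `V`, hence also its centralizer, then
`cm u l'` commutes with `a` for `l'` in the centralizer. For `u` coming from `1 + k l λ` with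
noncommuting `l`, `l'` and small `λ`, comparison of linear terms yields unipotency of `a`. -/
lemma tau_iterate_eq_zero_of_normalizes {V : Subfield D} {a k l l' : D} {n : ℕ} (ha : a ∈ V)
    (ha0 : a ≠ 0) (hl : l ∈ cent (V : Set D)) (hl' : l' ∈ cent (V : Set D)) (hll : l * l' ≠ l' * l)
    (h : ∀ y, y ≠ 0 → Normalizes ((cm a)^[n] y) V) (hk : k ∈ V) : (tau a)^[n + 1] k = 0 := by
  have hlam := (Infinite.natEmbedding (Subring.center D)).injective
  have hl0 : l' ≠ 0 := by rintro rfl; simp at hll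
  have h0 := Expansion.one_add hlam (k * l)
  have h1 := h0.cm_iterate hlam ha0 n
  have h2 := (h1.mul hlam ((h1.inv hlam).conj hlam hl0)).cm hlam ha0
  have h3 := h2.eq_zero hlam ((h0.eventually_ne_zero hlam).mono fun i hi => ?_)
  · have hal : ∀ m ∈ cent (V : Set D), a * m = m * a := fun m hm => mem_cent.1 hm a ha
    have hkt : (tau a)^[n] k ∈ V := tau_iterate_mem ha hk n
    have e : (tau a)^[n] (k * l) + l' * -(tau a)^[n] (k * l) * l'⁻¹ =
        (tau a)^[n] k * (l - l' * l * l'⁻¹) := by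
      rw [tau_iterate_mul (hal l hl), mul_neg, neg_mul, ← mul_assoc l', ← mem_cent.1 hl' _ hkt]
      noncomm_ring
    have hm : l - l' * l * l'⁻¹ ∈ cent (V : Set D) :=
      sub_mem hl (mul_mem (mul_mem hl' hl) (inv_mem hl'))
    rw [e, ← Function.iterate_one (tau a), tau_iterate_mul (hal _ hm)] at h3
    rw [Function.iterate_succ_apply']
    refine (mul_eq_zero.1 h3).resolve_right fun h4 => hll ?_
    rw [sub_eq_zero, eq_mul_inv_iff_mul_eq₀ hl0] at h4
    exact h4
  · set u := (AlmostSubnormal.cm a)^[n] (1 + k * l * _) with hu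
    have hu1 : Normalizes u V := h _ hi
    have hψ : u * (l' * u⁻¹ * l'⁻¹) ∈ cent (V : Set D) := by
      have := mul_mem (hu1.cent_subfield.conj l' hl') (inv_mem hl')
      simpa only [mul_assoc] using this
    have hψ0 : u * (l' * u⁻¹ * l'⁻¹) ≠ 0 :=
      mul_ne_zero hu1.ne (mul_ne_zero (mul_ne_zero hl0 (inv_ne_zero hu1.ne)) (inv_ne_zero hl0))
    exact (cm_eq_one_iff ha0 hψ0).2 (mem_cent.1 hψ a ha)

lemma infinite_of_center_le {P : Subfield D} {a : D} (h : ∀ t ∈ Subring.center D, t ∈ P) :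
    {t | t ∈ P ∧ a * t = t * a}.Infinite := by
  refine (Set.infinite_coe_iff (s := (Subring.center D : Set D)).1 ‹_›).mono ?_
  exact fun t ht => ⟨h t ht, mem_center_iff.1 ht a⟩

/-- Over an infinite center, an element all of whose iterated commutators become trivial is
central. -/
theorem mem_center_of_cm_iterate {a : D} (ha : a ≠ 0) {N : ℕ}
    (h : ∀ y, y ≠ 0 → (cm a)^[N] y = 1) : a ∈ Subring.center D := by
  by_contra hne
  rw [mem_center_iff] at hne
  push Not at hne
  obtain ⟨k, hk⟩ := hne
  obtain ⟨v, -, hv⟩ := exists_conj_eq_add_one (V := ⊤) (k := k) trivial ha trivial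
    (tau_iterate_eq_zero_of_cm ha h k) (Ne.symm hk)
  set S : Set D := insert v (Subring.center D : Set D) with hS
  have hz : ∀ t ∈ Subring.center D, ∀ b, b * t = t * b := fun t ht => mem_center_iff.1 ht
  have hcomm : ∀ x ∈ S, ∀ y ∈ S, x * y = y * x := by
    rintro x (rfl | hx) y (rfl | hy)
    exacts [rfl, hz y hy _, (hz x hx _).symm, hz y hy x]
  have hvS : v ∈ Subfield.closure S := Subfield.subset_closure (Or.inl rfl)
  have hFS : ∀ t ∈ Subring.center D, t ∈ Subfield.closure S := fun t ht =>
    Subfield.subset_closure (Or.inr ht)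
  have hv' : a⁻¹ * v * a = v - 1 := by
    rw [eq_sub_iff_add_eq, ← mul_right_inj' ha, mul_add, mul_one, ← mul_assoc, ← mul_assoc,
      mul_inv_cancel₀ ha, one_mul, ← add_one_mul, ← hv, inv_mul_cancel_right₀ ha]
  have hn : Normalizes a (Subfield.closure S) := by
    refine ⟨ha, fun x hx => closure_conj_mem ha ?_ hx, fun x hx => ?_⟩
    · rintro s (rfl | hs)
      · rw [hv]
        exact add_mem hvS (one_mem _)
      · rw [(conj_eq_self_iff ha).2 (hz s hs a)]
        exact hFS s hs
    · have := closure_conj_mem (S := S) (inv_ne_zero ha) ?_ hx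
      · rwa [inv_inv] at this
      · rintro s (rfl | hs)
        · rw [inv_inv, hv']
          exact sub_mem hvS (one_mem _)
        · rw [(conj_eq_self_iff (inv_ne_zero ha)).2 (hz s hs _)]
          exact hFS s hs
  have := comm_of_cm_iterate _ (closure_comm hcomm) hn (infinite_of_center_le hFS) hvS N
    fun t _ _ h0 => h _ h0
  rw [(conj_eq_self_iff ha).2 this] at hv
  exact one_ne_zero (left_eq_add.1 hv)

end Ultrapower

/-! ### Commutative invariant division subrings -/

section Commutative

variable {D : Type*} [DivisionRing D] {G : Subgroup Dˣ} {n : ℕ} {K : Subfield D}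

lemma cm_iterate_comm_of_mem (hG : SubnormalOfDepth n G) (hK : Invariant G K)
    (hcomm : ∀ x ∈ K, ∀ y ∈ K, x * y = y * x) {a y : D} (ha : a ∈ elts G) (haK : a ∈ K)
    (hy : y ≠ 0) : (cm a)^[n + 2] y = 1 := by
  have ha0 := ne_zero_of_mem ha
  have hu := hG.cm_iterate_mem hy ha
  rw [Function.iterate_succ_apply', Function.iterate_succ_apply', cm_eq_one_iff ha0
    (cm_ne_zero ha0 (ne_zero_of_mem hu))]
  exact hcomm a haK _ (cm_mem_of_mem haK (hK _ hu))

lemma cm_iterate_eq_one_of_central (hG : SubnormalOfDepth n G) (hK : Invariant G K)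
    (hc : ∀ a ∈ elts G, a ∈ K → a ∈ Subring.center D) {h y : D} (hh : h ∈ elts G) (hy : y ∈ K)
    (hy0 : y ≠ 0) : (cm h)^[n + 1] y = 1 := by
  have h0 := ne_zero_of_mem hh
  have hu := hG.cm_iterate_mem hy0 hh
  rw [Function.iterate_succ_apply', cm_eq_one_iff h0 (ne_zero_of_mem hu)]
  exact mem_center_iff.1 (hc _ hu (cm_iterate_mem_of_normalizes (hK h hh) hy n)) h

/-- Over an infinite center, commutative invariant division subrings commute with `G`. -/
theorem commute_of_infinite_center [Infinite (Subring.center D)] (hG : SubnormalOfDepth n G)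
    (hK : Invariant G K)
    (hcomm : ∀ x ∈ K, ∀ y ∈ K, x * y = y * x) {h v : D} (hh : h ∈ elts G) (hv : v ∈ K) :
    h * v = v * h := by
  -- the double centralizer of `K` is commutative and contains the center
  let L := cent (cent (K : Set D) : Set D)
  have hL : Invariant G L := hK.cent.cent
  have hLcomm : ∀ x ∈ L, ∀ y ∈ L, x * y = y * x := cent_cent_comm hcomm
  have hc : ∀ a ∈ elts G, a ∈ L → a ∈ Subring.center D := fun a ha haL =>
    mem_center_of_cm_iterate (ne_zero_of_mem ha) fun y hy =>
      cm_iterate_comm_of_mem hG hL hLcomm ha haL hy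
  exact comm_of_cm_iterate L hLcomm (hL h hh)
    (infinite_of_center_le fun t ht => center_le_cent ht) (mem_cent_cent hv) (n + 1)
    fun t ht _ h0 => cm_iterate_eq_one_of_central hG hL hc hh (add_mem (mem_cent_cent hv) ht) h0

end Commutative
section Centralizer

variable {D : Type*} [DivisionRing D] {G : Subgroup Dˣ} {n : ℕ} {K : Subfield D}

lemma infinite_center_of_commute {E : Subfield D} {T : Set D} (hT : T.Infinite)
    (h : ∀ t ∈ T, t ∈ E ∧ ∀ x ∈ E, x * t = t * x) : Infinite (Subring.center E) := by
  have := hT.to_subtype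
  refine Infinite.of_injective
    (fun t : T => (⟨⟨t, (h t t.2).1⟩, mem_center_iff.2 fun x => Subtype.ext ((h t t.2).2 x x.2)⟩ :
      Subring.center E)) fun s t hst => Subtype.ext ?_
  exact congrArg (fun x : Subring.center E => ((x : E) : D)) hst

lemma injective_pow_of_pow_ne_one {c : D} (hc : c ≠ 0) (h : ∀ r > 0, c ^ r ≠ 1) :
    Function.Injective fun i : ℕ => c ^ i := by
  refine Function.Injective.of_eq_imp_le fun {i j} hij => ?_
  by_contra! hlt
  refine h (i - j) (by omega) (mul_right_cancel₀ (pow_ne_zero j hc) ?_)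
  rw [← pow_add, Nat.sub_add_cancel hlt.le, one_mul]
  exact hij

/-- A conjugation by an element of `G` that has finite order at an element `v` of a commutative
invariant division subring fixes `v`. If it fixes infinitely many elements of a suitable field
containing `v`, these become central in their centralizer. -/
theorem commute_of_pow_commute (hG : SubnormalOfDepth n G) (hK : Invariant G K)
    (hcomm : ∀ x ∈ K, ∀ y ∈ K, x * y = y * x) {h v : D} (hh : h ∈ elts G) (hv : v ∈ K) {r : ℕ}
    (hr : 0 < r) (hrv : h ^ r * v = v * h ^ r) : h * v = v * h := by
  have h0 := ne_zero_of_mem hh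
  have hhK := hK h hh
  set S : Set D := {s | s = h ^ r ∨ s ∈ K ∧ h ^ r * s = s * h ^ r} with hS
  have hScomm : ∀ x ∈ S, ∀ y ∈ S, x * y = y * x := by
    rintro x (rfl | ⟨hx, hx'⟩) y (rfl | ⟨hy, hy'⟩)
    exacts [rfl, hy', hx'.symm, hcomm x hx y hy]
  have hcr : Commute h (h ^ r) := Commute.self_pow h r
  have hn : Normalizes h (cent (cent S : Set D)) := by
    refine (Normalizes.cent h0 ?_ ?_).cent_subfield
    · rintro s (rfl | ⟨hs, hs'⟩)
      · exact Or.inl ((conj_eq_self_iff h0).2 hcr.eq)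
      · refine Or.inr ⟨hhK.conj s hs, ?_⟩
        exact ((hcr.symm.mul_right hs').mul_right hcr.symm.inv_right₀).eq
    · rintro s (rfl | ⟨hs, hs'⟩)
      · refine Or.inl ?_
        rw [mul_assoc, ← hcr.eq, inv_mul_cancel_left₀ h0]
      · refine Or.inr ⟨hhK.conj_inv s hs, ?_⟩
        exact ((hcr.symm.inv_right₀.mul_right hs').mul_right hcr.symm).eq
  set Q := cent (cent S : Set D) with hQ
  have hQcomm : ∀ x ∈ Q, ∀ y ∈ Q, x * y = y * x := cent_cent_comm hScomm
  have hvQ : v ∈ Q := mem_cent_cent (Or.inr ⟨hv, hrv⟩)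
  set T : Set D := {t | t ∈ Q ∧ h * t = t * h} with hT
  by_cases hfin : T.Finite
  · exact comm_of_fixed_finite Q hQcomm hn hr (mem_cent_cent (Or.inl rfl)) hfin hvQ
  · set E := cent T
    have hhE : h ∈ E := mem_cent.2 fun t ht => ht.2.symm
    have hvE : v ∈ E := mem_cent.2 fun t ht => hQcomm t ht.1 v hvQ
    have : Infinite (Subring.center E) := infinite_center_of_commute hfin fun t ht =>
      ⟨mem_cent.2 fun s hs => hQcomm s hs.1 t ht.1, fun x hx => (mem_cent.1 hx t ht).symm⟩
    have := commute_of_infinite_center (hG.restrict E) (hK.restrict E)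
      (fun x hx y hy => Subtype.ext (hcomm x hx y hy)) (h := ⟨h, hhE⟩) (v := ⟨v, hvE⟩)
      (mem_elts_restrict.2 hh) hv
    exact congrArg Subtype.val this

universe u

/-- In all division rings, a subnormal subgroup of depth `n` is central or has central
centralizer. -/
def CentralizersCentral (n : ℕ) : Prop :=
  ∀ (D : Type u) [DivisionRing D] (G : Subgroup Dˣ), SubnormalOfDepth n G →
    (∀ g ∈ elts G, g ∈ Subring.center D) ∨
      ∀ x : D, (∀ g ∈ elts G, g * x = x * g) → x ∈ Subring.center D

variable {D : Type u} [DivisionRing D] {G : Subgroup Dˣ} {K : Subfield D}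

lemma pow_conj_eq_pow_mul {h v c : D} (h0 : h ≠ 0) (hc : h * c = c * h) (hv : h * v * h⁻¹ = c * v)
    (i : ℕ) : h ^ i * v = c ^ i * v * h ^ i := by
  have hcw : h * v = c * v * h := by rw [← hv, inv_mul_cancel_right₀ h0]
  induction i with
  | zero => simp
  | succ i ih =>
    have hci : h * c ^ i = c ^ i * h := (show Commute h c from hc).pow_right i
    rw [pow_succ', mul_assoc, ih, ← mul_assoc, ← mul_assoc, hci, mul_assoc (c ^ i), hcw]
    simp only [pow_succ, mul_assoc]

lemma linearIndependent_of_pow_not_commute {x a : D} (hx : Normalizes x K)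
    (hcomm : ∀ x ∈ K, ∀ y ∈ K, x * y = y * x) (ha : a ∈ K)
    (h : ∀ r > 0, x ^ r * a ≠ a * x ^ r) : LinearIndependent K fun i : ℕ => x ^ i := by
  by_contra hd
  obtain ⟨r, hr, k, hk, hk0, hkr⟩ := exists_mul_pow_commute hx hd
  refine h r hr (mul_left_cancel₀ hk0 ?_)
  rw [← mul_assoc, hkr a ha, ← mul_assoc, ← mul_assoc, hcomm a ha k hk]

/-- A commutative invariant division subring `K` commutes with `G`. Elements `a` of `G ∩ K` are
central, since otherwise some `x ∈ G` not commuting with `a` would have independent powers over `K`.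
-/
theorem commute_of_comm (hC : CentralizersCentral.{u} n) (hG : SubnormalOfDepth n G)
    (hK : Invariant G K) (hcomm : ∀ x ∈ K, ∀ y ∈ K, x * y = y * x) {h v : D} (hh : h ∈ elts G)
    (hv : v ∈ K) : h * v = v * h := by
  rcases hC D G hG with hz | hcent
  · exact (mem_center_iff.1 (hz h hh) v).symm
  have hc : ∀ a ∈ elts G, a ∈ K → a ∈ Subring.center D := by
    intro a ha haK
    by_contra hne
    obtain ⟨x, hx, hxa⟩ : ∃ x ∈ elts G, x * a ≠ a * x := by
      by_contra! h'
      exact hne (hcent a h')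
    have hind := linearIndependent_of_pow_not_commute (hK x hx) hcomm haK fun r hr hxr =>
      hxa (commute_of_pow_commute hG hK hcomm hx haK hr hxr)
    obtain ⟨k, hk, hk0, hak⟩ := exists_commute_mul hG hK (hK x hx) hind ha haK
    rw [← mul_assoc, hcomm a haK k hk, mul_assoc, mul_assoc] at hak
    exact hxa (mul_left_cancel₀ hk0 hak).symm
  by_contra hne
  have h0 := ne_zero_of_mem hh
  have hv0 : v ≠ 0 := by rintro rfl; simp at hne
  -- the last iterated commutator `w` of `h` and `v` that does not commute with `h`
  obtain ⟨j, hj, hj1⟩ : ∃ j, h * (cm h)^[j] v ≠ (cm h)^[j] v * h ∧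
      h * (cm h)^[j + 1] v = (cm h)^[j + 1] v * h := by
    by_contra! hall
    have : ∀ j, h * (cm h)^[j] v ≠ (cm h)^[j] v * h := fun j => by
      induction j with
      | zero => exact hne
      | succ j ih => exact hall j ih
    refine this (n + 1) ?_
    rw [cm_iterate_eq_one_of_central hG hK hc hh hv hv0, mul_one, one_mul]
  rw [Function.iterate_succ_apply'] at hj1
  have hwK : (cm h)^[j] v ∈ K := cm_iterate_mem_of_normalizes (hK h hh) hv j
  have hw0 := cm_iterate_ne_zero h0 hv0 j
  set w := (cm h)^[j] v
  set c := cm h w with hcdef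
  have hcK : c ∈ K := cm_mem_of_normalizes (hK h hh) hwK
  have hc0 : c ≠ 0 := cm_ne_zero h0 hw0
  by_cases htors : ∃ r > 0, c ^ r = 1
  · obtain ⟨r, hr, hcr⟩ := htors
    refine hj (commute_of_pow_commute hG hK hcomm hh hwK hr ?_)
    rw [pow_conj_eq_pow_mul h0 hj1 (conj_eq_cm_mul hw0), hcr, one_mul]
  · have hinj := injective_pow_of_pow_ne_one hc0 fun r hr hcr => htors ⟨r, hr, hcr⟩
    refine hj (comm_of_cm_iterate K hcomm (hK h hh) ?_ hwK (n + 1) fun t ht _ h0 =>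
      cm_iterate_eq_one_of_central hG hK hc hh (add_mem hwK ht) h0)
    exact Set.infinite_of_injective_forall_mem hinj fun i =>
      ⟨pow_mem hcK i, (show Commute h c from hj1).pow_right i⟩

end Centralizer
/-! ### Invariant division subrings meeting `G` in the center -/

section Torus

universe u

variable {D : Type u} [DivisionRing D] {G : Subgroup Dˣ} {n : ℕ} {K : Subfield D}

lemma tau_iterate_eq_pow_mul {h v c : D} (hc : c ∈ Subring.center D)
    (hv : h * v * h⁻¹ = c * v) (i : ℕ) : (tau h)^[i] v = (c - 1) ^ i * v := by
  induction i with
  | zero => simp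
  | succ i ih =>
    have hcc : ∀ y, y * (c - 1) ^ i = (c - 1) ^ i * y :=
      mem_center_iff.1 (pow_mem (sub_mem hc (one_mem _)) i)
    rw [Function.iterate_succ_apply', ih, tau, ← mul_assoc, hcc, mul_assoc, mul_assoc,
      ← mul_assoc h, hv, pow_succ]
    noncomm_ring

lemma self_mem_spanSubfield {W : Subfield D} {t : D} (ht : Normalizes t W) {r : ℕ}
    (hr : t ^ r ∈ spanLT W t r) : t ∈ spanSubfield ht hr := by
  rw [mem_spanSubfield]
  rcases Nat.lt_trichotomy r 1 with h | rfl | h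
  · obtain rfl : r = 0 := by omega
    simp [spanLT_zero] at hr
  · rwa [pow_one] at hr
  · have := pow_mem_spanLT (V := W) (z := t) h
    rwa [pow_one] at this

instance {W : Subfield D} [Finite W] {t : D} (ht : Normalizes t W) {r : ℕ}
    (hr : t ^ r ∈ spanLT W t r) : Finite (spanSubfield ht hr) :=
  Module.finite_of_finite W (M := spanLT W t r)

lemma exists_pow_eq_one {E : Subfield D} [Finite E] {t : D} (ht : t ∈ E) (h0 : t ≠ 0) :
    ∃ r > 0, t ^ r = 1 := by
  by_contra! h
  have := injective_pow_of_pow_ne_one h0 h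
  exact Set.infinite_of_injective_forall_mem this (fun i => pow_mem ht i) (Set.toFinite (E : Set D))

/-- An element `h` of `G` that acts on an element `v` of `K` by multiplication with a central
element commutes with `v`, provided that its iterated commutators with `K` become trivial. The only
serious case is that `v` generates a finite field together with `c` while `h` has infinite order;
then some power `t` of `h` commutes with `v`, is transcendental over `K ∩ cent {t}`, and first-order
expansion in `t` shows that `v` is central in `K ∩ cent {t}`. -/
theorem commute_of_conj_eq_mul (hC : CentralizersCentral.{u} n) (hG : SubnormalOfDepth n G)
    (hK : Invariant G K) {h v c : D} (hh : h ∈ elts G) (hv : v ∈ K) (hv0 : v ≠ 0)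
    (hc : c ∈ Subring.center D) (hvc : h * v * h⁻¹ = c * v) {N : ℕ}
    (hN : ∀ y ∈ K, y ≠ 0 → (cm h)^[N] y = 1) : h * v = v * h := by
  by_contra hne
  have h0 := ne_zero_of_mem hh
  have hcz := mem_center_iff.1 hc
  have hcK : c ∈ K := by
    have : c = h * v * h⁻¹ * v⁻¹ := by rw [hvc, mul_inv_cancel_right₀ hv0]
    rw [this]
    exact mul_mem ((hK h hh).conj v hv) (inv_mem hv)
  have hc0 : c ≠ 0 := by
    rintro rfl
    simp [h0, hv0] at hvc
  have hconj_inv : h⁻¹ * v * h = c⁻¹ * v := by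
    have e : h * v = c * v * h := by rw [← hvc, inv_mul_cancel_right₀ h0]
    rw [eq_inv_mul_iff_mul_eq₀ hc0, ← mul_assoc, ← mul_assoc, ← hcz h⁻¹, mul_assoc h⁻¹, mul_assoc,
      ← e, inv_mul_cancel_left₀ h0]
  -- A commutative subfield of `K` generated by `v` and elements commuting with `h` has only
  -- finitely many elements commuting with `h`.
  have key : ∀ S : Set D, (∀ x ∈ S, ∀ y ∈ S, x * y = y * x) → S ⊆ K → (∀ x ∈ S, h * x = x * h) →
      (∀ x ∈ S, v * x = x * v) → c ∈ S →
      Normalizes h (Subfield.closure (insert v S)) ∧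
      (∀ x ∈ Subfield.closure (insert v S), ∀ y ∈ Subfield.closure (insert v S),
        x * y = y * x) ∧
      {t | t ∈ Subfield.closure (insert v S) ∧ h * t = t * h}.Finite := by
    intro S hS hSK hSh hSv hcS
    set P := Subfield.closure (insert v S)
    have hPK : P ≤ K := Subfield.closure_le.2 (Set.insert_subset hv hSK)
    have hvP : v ∈ P := Subfield.subset_closure (Set.mem_insert _ _)
    have hSP : ∀ x ∈ S, x ∈ P := fun x hx => Subfield.subset_closure (Set.mem_insert_of_mem _ hx)
    have hcomm : ∀ x ∈ P, ∀ y ∈ P, x * y = y * x := by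
      refine closure_comm ?_
      rintro x (rfl | hx) y (rfl | hy)
      exacts [rfl, hSv y hy, (hSv x hx).symm, hS x hx y hy]
    have hn : Normalizes h P := by
      refine ⟨h0, fun x hx => closure_conj_mem h0 ?_ hx, fun x hx => ?_⟩
      · rintro s (rfl | hs)
        · rw [hvc]
          exact mul_mem (hSP c hcS) hvP
        · rw [(conj_eq_self_iff h0).2 (hSh s hs)]
          exact hSP s hs
      · have := closure_conj_mem (S := insert v S) (inv_ne_zero h0) ?_ hx
        · rwa [inv_inv] at this
        · rintro s (rfl | hs)
          · rw [inv_inv, hconj_inv]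
            exact mul_mem (inv_mem (hSP c hcS)) hvP
          · rw [(conj_eq_self_iff (inv_ne_zero h0)).2
              (show Commute h s from hSh s hs).inv_left₀.eq]
            exact hSP s hs
    refine ⟨hn, hcomm, ?_⟩
    by_contra hinf
    exact hne (comm_of_cm_iterate P hcomm hn hinf hvP N fun t ht _ h1 =>
      hN _ (hPK (add_mem hvP ht)) h1)
  obtain ⟨hn, hPcomm, hPfin⟩ := key {c} (by rintro x rfl y rfl; rfl) (by rintro x rfl; exact hcK)
    (by rintro x rfl; exact hcz h) (by rintro x rfl; exact hcz v) rfl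
  set P := Subfield.closure (insert v {c}) with hP
  have hvP : v ∈ P := Subfield.subset_closure (Set.mem_insert _ _)
  have hcP : c ∈ P := Subfield.subset_closure (Set.mem_insert_of_mem _ rfl)
  obtain ⟨r, hr, hcr⟩ : ∃ r > 0, c ^ r = 1 := by
    by_contra! h'
    exact Set.infinite_of_injective_forall_mem (injective_pow_of_pow_ne_one hc0 h')
      (fun i => show c ^ i ∈ {t | t ∈ P ∧ h * t = t * h} from
        ⟨pow_mem hcP i, mem_center_iff.1 (pow_mem hc i) h⟩) hPfin
  set t := h ^ r with ht
  have ht0 : t ≠ 0 := pow_ne_zero r h0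
  have htv : t * v = v * t := by
    rw [ht, pow_conj_eq_pow_mul h0 (hcz h) hvc, hcr, one_mul]
  have htP : ∀ x ∈ P, t * x = x * t := by
    have : P ≤ cent {t} := closure_le_cent fun x hx y hy => by
      obtain rfl : y = t := hy
      rcases hx with rfl | rfl
      · exact htv
      · exact hcz _
    exact fun x hx => mem_cent.1 (this hx) t rfl
  have hPfinite : Finite P := finite_of_comm_fixed_finite P hPcomm hn hr htP hPfin
  -- `t` has infinite order, since otherwise `h` and `P` generate a finite division ring
  have htors : ∀ s > 0, t ^ s ≠ 1 := fun s hs hts => by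
    refine hne (comm_of_finite P hn (r := r * s) (Nat.mul_pos hr hs) ?_ hvP)
    rw [pow_mul, ← ht, hts]
    exact one_mem P
  -- pass to the centralizer of `t`
  set E := cent ({t} : Set D) with hE
  have hmemE : ∀ {x : D}, x ∈ E ↔ t * x = x * t := fun {x} => by
    rw [hE, mem_cent]
    simp
  have hhE : h ∈ E := hmemE.2 (Commute.pow_self h r).eq
  have hvE : v ∈ E := hmemE.2 htv
  have htE : t ∈ E := hmemE.2 rfl
  let K₁ := K.comap E.subtype
  let Z := K₁ ⊓ cent (K₁ : Set E)
  let h' : E := ⟨h, hhE⟩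
  let v' : E := ⟨v, hvE⟩
  let t' : E := ⟨t, htE⟩
  have hG₁ := hG.restrict E
  have hK₁ : Invariant (restrict G E) K₁ := hK.restrict E
  have hh' : h' ∈ elts (restrict G E) := mem_elts_restrict.2 hh
  have hZ : Invariant (restrict G E) Z := hK₁.inf_cent
  have hZcomm : ∀ x ∈ Z, ∀ y ∈ Z, x * y = y * x := inf_cent_comm K₁
  have hZh : ∀ x ∈ Z, h' * x = x * h' := fun x hx => commute_of_comm hC hG₁ hZ hZcomm hh' hx
  have hZfin : Finite Z := by
    let S : Set D := Subtype.val '' (Z : Set E)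
    have := (key S ?_ ?_ ?_ ?_ ?_).2.2
    · refine Set.Finite.of_finite_image (f := (Subtype.val : E → D)) (this.subset ?_)
        Subtype.val_injective.injOn
      rintro _ ⟨x, hx, rfl⟩
      exact ⟨Subfield.subset_closure (Set.mem_insert_of_mem _ ⟨x, hx, rfl⟩),
        congrArg Subtype.val (hZh x hx)⟩
    · rintro _ ⟨x, hx, rfl⟩ _ ⟨y, hy, rfl⟩
      exact congrArg Subtype.val (hZcomm x hx y hy)
    · rintro _ ⟨x, hx, rfl⟩
      exact hx.1
    · rintro _ ⟨x, hx, rfl⟩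
      exact congrArg Subtype.val (hZh x hx)
    · rintro _ ⟨x, hx, rfl⟩
      exact congrArg Subtype.val (mem_cent.1 hx.2 v' hv)
    · exact ⟨⟨c, hmemE.2 (hcz t)⟩, ⟨hcK, mem_cent.2 fun s _ => Subtype.ext (hcz s)⟩, rfl⟩
  have ht0' : t' ≠ 0 := fun h => ht0 (congrArg Subtype.val h)
  have htcomm : ∀ x : E, t' * x = x * t' := fun x => Subtype.ext (hmemE.1 x.2)
  have htK₁ : Normalizes t' K₁ := Normalizes.of_comm ht0' fun x _ => htcomm x
  -- `t` is transcendental over `K ∩ E`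
  have hind : LinearIndependent K₁ fun i : ℕ => t' ^ i := by
    by_contra hd
    obtain ⟨s, hs⟩ := exists_pow_mem_spanLT_of_comm ht0' (fun b _ => htcomm b) hd (W := Z)
      fun x hx hx' => ⟨hx, mem_cent.2 fun b hb => (hx' b hb).symm⟩
    obtain ⟨m, hm, htm⟩ := exists_pow_eq_one
      (self_mem_spanSubfield (Normalizes.of_comm ht0' fun x _ => htcomm x) hs) ht0'
    exact htors m hm (congrArg Subtype.val htm)
  have hv' : v' ∈ K₁ := hv
  have hQ := commute_tau_iterate htK₁ hind (hK₁ h' hh') (one_mem K₁) one_ne_zero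
    (by rw [one_mul, ← htcomm, mul_inv_cancel_right₀ (ne_zero_of_mem hh')]) n hv'
    (hK₁ _ (hG₁.cm_iterate_mem (one_add_mul_ne_zero htK₁ hind hv') hh'))
  let c' : E := ⟨c, hmemE.2 (hcz t)⟩
  have hc' : c' ∈ Subring.center E := mem_center_iff.2 fun y => Subtype.ext (hcz y)
  have hvc' : h' * v' * h'⁻¹ = c' * v' := Subtype.ext hvc
  rw [tau_iterate_mul (htcomm h').symm, tau_iterate_eq_pow_mul hc' hvc'] at hQ
  have hc1 : c' - 1 ≠ 0 := fun h1 => by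
    rw [sub_eq_zero.1 h1, one_mul, conj_eq_self_iff (ne_zero_of_mem hh')] at hvc'
    exact hne (congrArg Subtype.val hvc')
  have hvZ : v' ∈ Z := by
    refine ⟨hv', mem_cent.2 fun b hb => ?_⟩
    have h1 := hQ b hb
    have h2 := mem_center_iff.1 (pow_mem (sub_mem hc' (one_mem _)) n) b
    rw [mul_assoc, mul_assoc, ← mul_assoc b, h2, mul_assoc, mul_assoc, htcomm b] at h1
    have h3 := mul_left_cancel₀ (pow_ne_zero n hc1) h1
    rw [← mul_assoc, ← mul_assoc] at h3
    exact mul_right_cancel₀ ht0' h3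
  exact hne (congrArg Subtype.val (hZh v' hvZ))

/-- The property of meeting `K` in central elements climbs a subnormal chain starting at `G`. -/
lemma mem_center_of_chain (hC : CentralizersCentral.{u} n) (hG : SubnormalOfDepth n G)
    (hGc : ¬ ∀ g ∈ elts G, g ∈ Subring.center D) (hK : Invariant G K)
    (hc : ∀ a ∈ elts G, a ∈ K → a ∈ Subring.center D) {m : ℕ} :
    ∀ H : Subgroup Dˣ, SubnormalOfDepth m H → G ≤ H →
      (∀ a ∈ elts H, a ∈ K → a ∈ Subring.center D) → ∀ x ∈ K, x ∈ Subring.center D := by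
  induction m with
  | zero =>
    rintro H rfl _ hH x hx
    by_cases hx0 : x = 0
    · exact hx0 ▸ zero_mem _
    · exact hH x (mem_elts_top hx0) hx
  | succ m ih =>
    rintro H ⟨H', hH', hle, hn⟩ hGH hH
    refine ih H' hH' (hGH.trans hle) fun w hw hwK => ?_
    have hw0 := ne_zero_of_mem hw
    refine ((hC D G hG).resolve_left hGc) w fun g hg => ?_
    refine commute_of_conj_eq_mul hC hG hK hg hwK hw0 (hH _ ?_ ?_) (conj_eq_cm_mul hw0)
      fun y hy hy0 => cm_iterate_eq_one_of_central hG hK hc hg hy hy0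
    · exact cm_mem_elts hn (elts_mono hGH hg) hw
    · exact cm_mem_of_normalizes (hK g hg) hwK

/-- An invariant division subring that meets a noncentral `G` in central elements is central. -/
theorem mem_center_of_inter (hC : CentralizersCentral.{u} n) (hG : SubnormalOfDepth n G)
    (hGc : ¬ ∀ g ∈ elts G, g ∈ Subring.center D) (hK : Invariant G K)
    (hc : ∀ a ∈ elts G, a ∈ K → a ∈ Subring.center D) : ∀ x ∈ K, x ∈ Subring.center D :=
  mem_center_of_chain hC hG hGc hK hc G hG le_rfl hc

end Torus
/-! ### Locally finite division subrings -/

section LocallyFinite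

open Polynomial

lemma prod_X_sub_C_eq (K : Type*) [Field K] [Fintype K] :
    ∏ c : K, (X - C c) = X ^ Fintype.card K - X := by
  have h1 : 1 < Fintype.card K := Fintype.one_lt_card
  have := prod_multiset_X_sub_C_of_monic_of_roots_card_eq (p := (X ^ Fintype.card K - X : K[X]))
    (monic_X_pow_sub (degree_X_le.trans_lt (by exact_mod_cast h1)))
    (by
      rw [FiniteField.roots_X_pow_card_sub_X, FiniteField.X_pow_card_sub_X_natDegree_eq K h1]
      rfl)
  rwa [FiniteField.roots_X_pow_card_sub_X] at this

variable {D : Type*} [DivisionRing D]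

lemma comm_of_finite_subfield (P : Subfield D) [Finite P] : ∀ x ∈ P, ∀ y ∈ P, x * y = y * x :=
  fun x hx y hy =>
    congrArg Subtype.val ((Finite.isDomain_to_isField P).mul_comm ⟨x, hx⟩ ⟨y, hy⟩)

/-- If an element `a` of a finite subfield `P` is not central in `L` then right multiplication by
`a` on the left `P`-vector space `L` has an eigenvalue other than `a`: it is a root of the product
of all `X - c`, `c ∈ P`. -/
lemma exists_mul_eq_mul {P L : Subfield D} [Finite P] (hPL : P ≤ L) {a y : D} (ha : a ∈ P)
    (hy : y ∈ L) (hay : y * a ≠ a * y) : ∃ x ∈ L, x ≠ 0 ∧ ∃ b ∈ P, b ≠ a ∧ x * a = b * x := by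
  classical
  let := commField P (comm_of_finite_subfield P)
  let := Fintype.ofFinite P
  let T : Module.End P D :=
    { toFun := fun w => w * a
      map_add' := fun x y => add_mul x y a
      map_smul' := fun c x => mul_assoc _ _ _ }
  have hT : ∀ w, T w = w * a := fun _ => rfl
  have hTL : ∀ (c : P) (w : D), w ∈ L → aeval T (X - C c) w ∈ L := fun c w hw => by
    have : aeval T (X - C c) w = w * a - c * w := by simp [hT, Subfield.smul_def]
    rw [this]
    exact sub_mem (mul_mem hw (hPL ha)) (mul_mem (hPL c.2) hw)
  have hind : ∀ (s : Finset P) (w : D), w ∈ L → w ≠ 0 → aeval T (∏ c ∈ s, (X - C c)) w = 0 →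
      ∃ x ∈ L, x ≠ 0 ∧ ∃ c ∈ s, x * a = c * x := by
    intro s
    induction s using Finset.induction_on with
    | empty => intro w _ hw h; simp [hw] at h
    | insert c s hcs ih =>
      intro w hw hw0 h
      rw [Finset.prod_insert hcs, mul_comm, map_mul, Module.End.mul_apply] at h
      by_cases h1 : aeval T (X - C c) w = 0
      · have : aeval T (X - C c) w = w * a - c * w := by simp [hT, Subfield.smul_def]
        exact ⟨w, hw, hw0, c, Finset.mem_insert_self _ _, sub_eq_zero.1 (this ▸ h1)⟩
      · obtain ⟨x, hx, hx0, d, hd, he⟩ := ih _ (hTL c w hw) h1 h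
        exact ⟨x, hx, hx0, d, Finset.mem_insert_of_mem hd, he⟩
  have hpow : ∀ (i : ℕ) (w : D), (T ^ i) w = w * a ^ i := fun i => by
    induction i with
    | zero => simp
    | succ i ih => intro w; rw [pow_succ, Module.End.mul_apply, ih, hT, mul_assoc, ← pow_succ']
  have haq : a ^ Fintype.card P = a :=
    congrArg Subtype.val (FiniteField.pow_card (⟨a, ha⟩ : P))
  have hy0 : aeval T (X - C (⟨a, ha⟩ : P)) y = y * a - a * y := by simp [hT, Subfield.smul_def]
  obtain ⟨x, hx, hx0, c, hc, he⟩ := hind (Finset.univ.erase ⟨a, ha⟩) _ (hTL ⟨a, ha⟩ y hy)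
    (by rw [hy0]; exact sub_ne_zero.2 hay) (by
      rw [← Module.End.mul_apply, ← map_mul, Finset.prod_erase_mul _ _ (Finset.mem_univ _),
        prod_X_sub_C_eq]
      simp [hpow, haq, hT])
  exact ⟨x, hx, hx0, c, c.2, fun h => (Finset.mem_erase.1 hc).1 (Subtype.ext h), he⟩

/-- Jacobson's theorem for division rings: a division subring all of whose elements lie in finite
subfields is commutative. -/
theorem comm_of_locally_finite (L : Subfield D)
    (hL : ∀ l ∈ L, ∃ P ≤ L, Finite P ∧ l ∈ P) : ∀ x ∈ L, ∀ y ∈ L, x * y = y * x := by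
  intro y hy a ha
  by_contra hay
  obtain ⟨P₀, hP₀L, hP₀, haP₀⟩ := hL a ha
  set P := Subfield.closure {a}
  have hPP₀ : P ≤ P₀ := Subfield.closure_le.2 (by simpa using haP₀)
  have : Finite P := Finite.of_injective _ (Subfield.inclusion hPP₀).injective
  have haP : a ∈ P := Subfield.subset_closure rfl
  obtain ⟨x, hx, hx0, b, hb, hba, he⟩ := exists_mul_eq_mul (hPP₀.trans hP₀L) haP hy hay
  have hconj : ∀ p ∈ P, x * p * x⁻¹ ∈ P := fun p hp => closure_conj_mem hx0 (by
    rintro s rfl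
    rw [he, mul_inv_cancel_right₀ hx0]
    exact hb) hp
  -- an injective endomorphism of a finite field is surjective
  have hn : Normalizes x P := by
    refine ⟨hx0, hconj, fun p hp => ?_⟩
    have hinj : Function.Injective fun p : P => (⟨x * p * x⁻¹, hconj p p.2⟩ : P) := by
      intro p q hpq
      have := congrArg Subtype.val hpq
      exact Subtype.ext (mul_left_cancel₀ hx0 (mul_right_cancel₀ (inv_ne_zero hx0) this))
    obtain ⟨q, hq⟩ := Finite.injective_iff_surjective.1 hinj ⟨p, hp⟩
    have hq' : x * q * x⁻¹ = p := congrArg Subtype.val hq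
    rw [← hq']
    simp [mul_assoc, hx0]
  obtain ⟨Px, -, hPx, hxP⟩ := hL x hx
  obtain ⟨r, hr, hxr⟩ := exists_pow_eq_one hxP hx0
  have := comm_of_finite P hn hr (hxr ▸ one_mem P) haP
  rw [this] at he
  exact hba (mul_right_cancel₀ hx0 he).symm

end LocallyFinite

/-! ### Centralizers of noncentral invariant division subrings -/

section NoncentralInvariant

universe u

variable {D : Type u} [DivisionRing D] {G : Subgroup Dˣ} {n : ℕ} {V : Subfield D}

lemma mem_center_of_comm (hC : CentralizersCentral.{u} n) (hG : SubnormalOfDepth n G)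
    (hGc : ¬ ∀ g ∈ elts G, g ∈ Subring.center D) (hV : Invariant G V)
    (hcomm : ∀ x ∈ V, ∀ y ∈ V, x * y = y * x) : ∀ x ∈ V, x ∈ Subring.center D := fun x hx =>
  ((hC D G hG).resolve_left hGc) x fun _ hg => commute_of_comm hC hG hV hcomm hg hx

/-- For a noncentral invariant `V`, the group `G ∩ V` is not central in `V`. -/
lemma exists_not_commute (hC : CentralizersCentral.{u} n) (hG : SubnormalOfDepth n G)
    (hGc : ¬ ∀ g ∈ elts G, g ∈ Subring.center D) (hV : Invariant G V)
    (hVc : ¬ ∀ x ∈ V, x ∈ Subring.center D) :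
    ∃ a ∈ elts G, a ∈ V ∧ ∃ k ∈ V, a * k ≠ k * a := by
  by_contra! h
  refine hVc (mem_center_of_inter hC hG hGc hV fun a ha haV => ?_)
  exact mem_center_of_comm hC hG hGc hV.inf_cent (inf_cent_comm V) a
    ⟨haV, mem_cent.2 fun k hk => (h a ha haV k hk).symm⟩

/-- The centralizer `L` of a noncentral invariant division subring `V` is central. It suffices that
`L` is commutative. Over a finite center, elements of `L` are algebraic over the finite center of
`V`, as otherwise `G ∩ V` would be central in `V`; over an infinite center, noncommuting elements of
`L` would make `G ∩ V` act unipotently on `V`. -/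
theorem cent_le_center (hC : CentralizersCentral.{u} n) (hG : SubnormalOfDepth n G)
    (hGc : ¬ ∀ g ∈ elts G, g ∈ Subring.center D) (hV : Invariant G V)
    (hVc : ¬ ∀ x ∈ V, x ∈ Subring.center D) : ∀ x ∈ cent (V : Set D), x ∈ Subring.center D := by
  refine mem_center_of_comm hC hG hGc hV.cent ?_
  obtain ⟨a, ha, haV, k, hk, hak⟩ := exists_not_commute hC hG hGc hV hVc
  rcases finite_or_infinite (Subring.center D) with hfin | hinf
  · have hZ : ∀ x ∈ V ⊓ cent (V : Set D), x ∈ Subring.center D :=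
      mem_center_of_comm hC hG hGc hV.inf_cent (inf_cent_comm V)
    have : Finite (V ⊓ cent (V : Set D) : Subfield D) :=
      Finite.of_injective (fun x => (⟨x, hZ x x.2⟩ : Subring.center D)) fun x y hxy =>
        Subtype.ext (by simpa using hxy)
    refine comm_of_locally_finite _ fun l hl => ?_
    by_cases hl0 : l = 0
    · refine ⟨V ⊓ cent (V : Set D), inf_le_right, this, hl0 ▸ zero_mem _⟩
    have hlV : ∀ b ∈ V, l * b = b * l := fun b hb => (mem_cent.1 hl b hb).symm
    obtain ⟨r, hr⟩ := exists_pow_mem_spanLT_of_comm hl0 hlV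
      (fun hind => hak (commute_of_linearIndependent hG hV (Normalizes.of_comm hl0 hlV) hind ha
        haV hk)) (W := V ⊓ cent (V : Set D))
      fun x hx hx' => ⟨hx, mem_cent.2 fun b hb => (hx' b hb).symm⟩
    have hn : Normalizes l (V ⊓ cent (V : Set D)) := Normalizes.of_comm hl0 fun b hb => hlV b hb.1
    refine ⟨spanSubfield hn hr, fun x hx => ?_, inferInstance, self_mem_spanSubfield hn hr⟩
    obtain ⟨c, rfl⟩ := mem_spanLT_iff.1 ((mem_spanSubfield hn hr).1 hx)
    exact sum_mem fun i _ => mul_mem (c i).2.2 (pow_mem hl i)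
  · by_contra! hne
    obtain ⟨l, hl, l', hl', hll⟩ := hne
    refine hak (commute_of_tau_nilpotent (n := n) (N := n + 1)
      (fun a ha _ y _ hy => hG.cm_iterate_mem hy ha) (fun a ha haV k hk => ?_) ha haV hk)
    exact tau_iterate_eq_zero_of_normalizes haV (ne_zero_of_mem ha) hl hl' hll
      (fun y hy => hV _ (hG.cm_iterate_mem hy ha)) hk

end NoncentralInvariant
/-! ### Monomials in finite extensions -/

section Extension

variable {D : Type*} [DivisionRing D] {K : Subfield D} {x : D}

lemma conj_mul_eq {w : D} (h : Normalizes w K) (b : D) : w * b = w * b * w⁻¹ * w := by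
  rw [inv_mul_cancel_right₀ h.ne]

/-- The computation behind the Cartan–Brauer–Hua theorem. -/
lemma commute_of_normalizes_one_add {y : D} (hy : y ∉ K) (h : Normalizes y K)
    (h1 : Normalizes (1 + y) K) : ∀ b ∈ K, y * b = b * y := by
  intro b hb
  set β := (1 + y) * b * (1 + y)⁻¹ with hβ
  set γ := y * b * y⁻¹ with hγ
  have hβK : β ∈ K := h1.conj b hb
  have hγK : γ ∈ K := h.conj b hb
  have e1 : (1 + y) * b = β * (1 + y) := conj_mul_eq h1 b
  have e2 : y * b = γ * y := conj_mul_eq h b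
  have e3 : (β - γ) * y = b - β := by
    have : b + γ * y = β + β * y := by
      rw [← e2]
      linear_combination (norm := noncomm_ring) e1
    linear_combination (norm := noncomm_ring) -this
  have e4 : β = γ := by
    by_contra hne
    refine hy ?_
    have hne' : β - γ ≠ 0 := sub_ne_zero.2 hne
    have : y = (β - γ)⁻¹ * (b - β) := by rw [← e3, inv_mul_cancel_left₀ hne']
    rw [this]
    exact mul_mem (inv_mem (sub_mem hβK hγK)) (sub_mem hb hβK)
  rw [e4, sub_self, zero_mul] at e3
  rw [e2, sub_eq_zero.1 e3.symm]

/-- The elements `k x ^ i f` with `k ∈ K` and `f` central. -/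
def IsMonomial (K : Subfield D) (x w : D) : Prop :=
  ∃ k ∈ K, ∃ i : ℕ, ∃ f ∈ Subring.center D, w = k * x ^ i * f

lemma IsMonomial.normalizes (hx : Normalizes x K) {w : D} (hw0 : w ≠ 0) (hw : IsMonomial K x w) :
    Normalizes w K := by
  obtain ⟨k, hk, i, f, hf, rfl⟩ := hw
  have hf0 := right_ne_zero_of_mul hw0
  have hk0 := left_ne_zero_of_mul (left_ne_zero_of_mul hw0)
  exact ((Normalizes.of_mem hk hk0).mul (hx.pow i)).mul
    (Normalizes.of_comm hf0 fun b _ => (mem_center_iff.1 hf b).symm)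

lemma cm_eq_mul_inv (u v : D) : cm u v = u * v * (v * u)⁻¹ := by
  simp only [cm, mul_inv_rev, mul_assoc]

/-- Modulo `K` and the center, monomials commute. -/
lemma IsMonomial.cm_mem (hx : Normalizes x K) {u v : D} (hu0 : u ≠ 0) (hv0 : v ≠ 0)
    (hu : IsMonomial K x u) (hv : IsMonomial K x v) : cm u v ∈ K := by
  obtain ⟨k, hk, i, f, hf, rfl⟩ := hu
  obtain ⟨l, hl, j, g, hg, rfl⟩ := hv
  have hmul : ∀ (k l : D) (i j : ℕ) (f g : D), f ∈ Subring.center D → g ∈ Subring.center D →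
      k * x ^ i * f * (l * x ^ j * g) =
        k * (x ^ i * l * (x ^ i)⁻¹) * (x ^ (i + j) * (f * g)) := by
    intro k l i j f g hf hg
    have h1 : f * (l * x ^ j * g) = l * x ^ j * (f * g) := by
      rw [← mul_assoc, ← mem_center_iff.1 hf, mul_assoc]
    rw [mul_assoc _ f, h1, pow_add]
    simp only [mul_assoc]
    rw [inv_mul_cancel_left₀ (pow_ne_zero i hx.ne)]
  have e1 := hmul k l i j f g hf hg
  have e2 := hmul l k j i g f hg hf
  rw [add_comm j i, mem_center_iff.1 hf g] at e2
  have h0 : x ^ (i + j) * (f * g) ≠ 0 :=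
    mul_ne_zero (pow_ne_zero _ hx.ne) (mul_ne_zero (right_ne_zero_of_mul hu0)
      (right_ne_zero_of_mul hv0))
  rw [cm_eq_mul_inv, e1, e2, mul_inv_rev, mul_assoc, mul_inv_cancel_left₀ h0]
  exact mul_mem (mul_mem hk ((hx.pow i).conj l hl))
    (inv_mem (mul_mem hl ((hx.pow j).conj k hk)))

/-- If `S ⊆ K` has central centralizer, an element of `∑ K x ^ i` conjugating `S` into `K` is a
monomial: its monomials act on `S` as it does. -/
lemma isMonomial_of_conj_mem (hx : Normalizes x K) {r : ℕ} (hmin : ∀ m < r, x ^ m ∉ spanLT K x m)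
    {S : Set D} (hSK : S ⊆ K) (hS : ∀ y ∈ cent S, y ∈ Subring.center D) {w : D}
    (hw : w ∈ spanLT K x r) (hw0 : w ≠ 0) (hwS : ∀ s ∈ S, w * s * w⁻¹ ∈ K) : IsMonomial K x w := by
  obtain ⟨c, rfl⟩ := mem_spanLT_iff.1 hw
  obtain ⟨i, -, hi⟩ := Finset.exists_ne_zero_of_sum_ne_zero hw0
  set w := ∑ i, (c i : D) * x ^ (i : ℕ)
  refine ⟨c i, (c i).2, i, ((c i : D) * x ^ (i : ℕ))⁻¹ * w, hS _ (mem_cent.2 fun s hs => ?_), ?_⟩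
  · set β := w * s * w⁻¹ with hβ
    have h1 : w * s = β * w := by rw [hβ, inv_mul_cancel_right₀ hw0]
    have h2 := coeff_mul_eq hx hmin (fun i => (c i).2) (hSK hs) (hwS s hs) h1 i
    rw [← mul_right_inj' hi, ← mul_assoc, h2, mul_assoc, mul_inv_cancel_left₀ hi, ← h1,
      ← mul_assoc, mul_inv_cancel_left₀ hi]
  · rw [mul_inv_cancel_left₀ hi]

end Extension

/-! ### Invariant division subrings of subnormal subgroups -/

section Subnormal

universe u

/-- In all division rings, a division subring invariant under a noncentral subnormal subgroup of
depth `n` is central or everything. -/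
def InvariantTrivial (n : ℕ) : Prop :=
  ∀ (D : Type u) [DivisionRing D] (G : Subgroup Dˣ), SubnormalOfDepth n G →
    (¬ ∀ g ∈ elts G, g ∈ Subring.center D) → ∀ K : Subfield D, Invariant G K →
      (∀ x ∈ K, x ∈ Subring.center D) ∨ K = ⊤

/-- The Cartan–Brauer–Hua theorem. -/
theorem invariantTrivial_zero : InvariantTrivial.{u} 0 := by
  rintro D _ G rfl - K hK
  refine or_iff_not_imp_right.2 fun hne => ?_
  obtain ⟨x, hx⟩ : ∃ x, x ∉ K := by
    by_contra! h
    exact hne (eq_top_iff.2 fun x _ => h x)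
  have key : ∀ y, y ∉ K → ∀ b ∈ K, y * b = b * y := fun y hy =>
    commute_of_normalizes_one_add hy (hK y (mem_elts_top (by rintro rfl; exact hy (zero_mem K))))
      (hK _ (mem_elts_top fun h => hy (by
        rw [← neg_eq_of_add_eq_zero_right h]
        exact neg_mem (one_mem K))))
  refine fun b hb => mem_center_iff.2 fun y => ?_
  by_cases hy : y ∈ K
  · have h1 := key (x + y) (fun h => hx (by simpa using sub_mem h hy)) b hb
    rw [add_mul, mul_add, key x hx b hb] at h1
    exact add_left_cancel h1
  · exact key y hy b hb

variable {n : ℕ}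

/-- Applied to the next term `H` of the chain, triviality of invariant division subrings shows that
`G` generates `D` and has central centralizer. -/
lemma InvariantTrivial.centralizer (hn : InvariantTrivial.{u} n) {D : Type u} [DivisionRing D]
    {G H : Subgroup Dˣ} (hH : SubnormalOfDepth n H) (hGH : G ≤ H)
    (hnorm : ∀ h ∈ H, ∀ g ∈ G, h * g * h⁻¹ ∈ G) (hGc : ¬ ∀ g ∈ elts G, g ∈ Subring.center D) :
    Subfield.closure (elts G) = ⊤ ∧
      ∀ x : D, (∀ g ∈ elts G, g * x = x * g) → x ∈ Subring.center D := by
  have hHc : ¬ ∀ g ∈ elts H, g ∈ Subring.center D := fun h => hGc fun g hg => h g (elts_mono hGH hg)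
  constructor
  · refine (hn D H hH hHc (Subfield.closure (elts G))
      (invariant_of_conj fun g hg x hx => ?_)).resolve_left
        fun h => hGc fun g hg => h g (Subfield.subset_closure hg)
    exact closure_conj_mem (ne_zero_of_mem hg)
      (fun s hs => Subfield.subset_closure (conj_mem_elts hnorm hg hs)) hx
  · have := (hn D H hH hHc (cent (elts G)) (fun g hg => Normalizes.cent (ne_zero_of_mem hg)
      (fun s hs => conj_mem_elts hnorm hg hs)
      (fun s hs => by simpa using conj_mem_elts hnorm (inv_mem_elts hg) hs))).resolve_right
      fun h => hGc fun g hg => mem_center_iff.2 fun y =>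
        (mem_cent.1 (h ▸ trivial : y ∈ cent (elts G)) g hg).symm
    exact fun x hx => this x (mem_cent.2 hx)

lemma InvariantTrivial.centralizersCentral (hn : InvariantTrivial.{u} n) :
    CentralizersCentral.{u} (n + 1) := by
  rintro D _ G ⟨H, hH, hGH, hnorm⟩
  exact or_iff_not_imp_left.2 fun hGc => (hn.centralizer hH hGH hnorm hGc).2

variable {D : Type u} [DivisionRing D] {G : Subgroup Dˣ} {K : Subfield D}

/-- The commutators of elements of `G ∩ K`. -/
def commutators (G : Subgroup Dˣ) (K : Subfield D) : Set D :=
  {z | ∃ a ∈ elts G, a ∈ K ∧ ∃ b ∈ elts G, b ∈ K ∧ cm a b = z}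

lemma conj_cm {g : D} (hg : g ≠ 0) (a b : D) :
    g * cm a b * g⁻¹ = cm (g * a * g⁻¹) (g * b * g⁻¹) := by
  simp [cm, mul_assoc, hg]

lemma conj_mem_commutators (hK : Invariant G K) {g s : D} (hg : g ∈ elts G)
    (hs : s ∈ commutators G K) : g * s * g⁻¹ ∈ commutators G K := by
  obtain ⟨a, ha, haK, b, hb, hbK, rfl⟩ := hs
  exact ⟨_, mul_mem_elts (mul_mem_elts hg ha) (inv_mem_elts hg), (hK g hg).conj a haK, _,
    mul_mem_elts (mul_mem_elts hg hb) (inv_mem_elts hg), (hK g hg).conj b hbK,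
    (conj_cm (ne_zero_of_mem hg) a b).symm⟩

lemma commutators_not_central (hC : CentralizersCentral.{u} n) (hG : SubnormalOfDepth n G)
    (hGc : ¬ ∀ g ∈ elts G, g ∈ Subring.center D) (hK : Invariant G K)
    (hKc : ¬ ∀ x ∈ K, x ∈ Subring.center D) :
    ¬ ∀ z ∈ commutators G K, z ∈ Subring.center D := by
  intro hM
  -- otherwise iterated commutators of `G ∩ K` with `K` become trivial
  have hN : ∀ a ∈ elts G, a ∈ K → ∀ y ∈ K, y ≠ 0 → (cm a)^[n + 2] y = 1 := by
    intro a ha haK y hy hy0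
    have ha0 := ne_zero_of_mem ha
    have hu := hG.cm_iterate_mem hy0 ha
    rw [Function.iterate_succ_apply', Function.iterate_succ_apply', cm_eq_one_iff ha0
      (cm_ne_zero ha0 (ne_zero_of_mem hu))]
    have hmem : cm a ((cm a)^[n] y) ∈ commutators G K :=
      ⟨a, ha, haK, _, hu, cm_iterate_mem_of_normalizes (hK a ha) hy n, rfl⟩
    exact mem_center_iff.1 (hM _ hmem) a
  have hcomm : ∀ a ∈ elts G ∩ K, ∀ b ∈ elts G ∩ K, a * b = b * a := by
    rintro a ⟨ha, haK⟩ b ⟨hb, hbK⟩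
    have hb0 := ne_zero_of_mem hb
    exact commute_of_conj_eq_mul hC hG hK ha hbK hb0 (hM _ ⟨a, ha, haK, b, hb, hbK, rfl⟩)
      (conj_eq_cm_mul hb0) (hN a ha haK)
  have hinv : Invariant G (Subfield.closure (elts G ∩ K)) := by
    refine invariant_of_conj fun g hg x hx => closure_conj_mem (ne_zero_of_mem hg) ?_ hx
    rintro s ⟨hs, hsK⟩
    exact Subfield.subset_closure ⟨mul_mem_elts (mul_mem_elts hg hs) (inv_mem_elts hg),
      (hK g hg).conj s hsK⟩
  exact hKc (mem_center_of_inter hC hG hGc hK fun a ha haK =>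
    mem_center_of_comm hC hG hGc hinv (closure_comm hcomm) a (Subfield.subset_closure ⟨ha, haK⟩))

lemma cent_commutators (hC : CentralizersCentral.{u} n) (hG : SubnormalOfDepth n G)
    (hGc : ¬ ∀ g ∈ elts G, g ∈ Subring.center D) (hK : Invariant G K)
    (hKc : ¬ ∀ x ∈ K, x ∈ Subring.center D) :
    ∀ y ∈ cent (commutators G K), y ∈ Subring.center D := by
  intro y hy
  have hinv : Invariant G (Subfield.closure (commutators G K)) :=
    invariant_of_conj fun g hg x hx => closure_conj_mem (ne_zero_of_mem hg)
      (fun s hs => Subfield.subset_closure (conj_mem_commutators hK hg hs)) hx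
  refine cent_le_center hC hG hGc hinv (fun h => commutators_not_central hC hG hGc hK hKc
    fun z hz => h z (Subfield.subset_closure hz)) y (mem_cent.2 fun s hs => ?_)
  have : Subfield.closure (commutators G K) ≤ cent {y} := closure_le_cent fun z hz t ht => by
    obtain rfl : t = y := ht
    exact (mem_cent.1 hy z hz).symm
  exact (mem_cent.1 (this hs) y rfl).symm

/-- Normalization of `K` climbs the subnormal chain, inside a finite extension `∑ K x ^ i`: an
element of the next term conjugates elements of `G ∩ K` to monomials, and so their commutators into
`K`. -/
lemma normalizes_of_mem_spanLT {x : D} (hx : Normalizes x K) {r : ℕ} (hr : x ^ r ∈ spanLT K x r)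
    (hmin : ∀ m < r, x ^ m ∉ spanLT K x m)
    (hcK : ∀ y ∈ cent (K : Set D), y ∈ Subring.center D)
    (hcM : ∀ y ∈ cent (commutators G K), y ∈ Subring.center D) {m : ℕ} :
    ∀ H : Subgroup Dˣ, SubnormalOfDepth m H → G ≤ H →
      (∀ w ∈ elts H, w ∈ spanLT K x r → Normalizes w K) →
        ∀ w ∈ spanLT K x r, w ≠ 0 → Normalizes w K := by
  have hr0 : 0 < r := by
    rcases Nat.eq_zero_or_pos r with rfl | h
    · simp [spanLT_zero] at hr
    · exact h
  induction m with
  | zero => rintro H rfl _ hH w hw hw0; exact hH w (mem_elts_top hw0) hw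
  | succ m ih =>
    rintro H ⟨H', hH', hle, hnorm⟩ hGH hH
    refine ih H' hH' (hGH.trans hle) fun w hw hwE => ?_
    have hw0 := ne_zero_of_mem hw
    have hmono : ∀ a ∈ elts G, a ∈ K → IsMonomial K x (w * a * w⁻¹) := by
      intro a ha haK
      have h1 : w * a * w⁻¹ ∈ elts H := conj_mem_elts hnorm hw (elts_mono hGH ha)
      have h2 : w * a * w⁻¹ ∈ spanSubfield hx hr :=
        mul_mem (mul_mem hwE (mem_spanLT_of_mem haK hr0 : a ∈ spanSubfield hx hr))
          (inv_mem (s := spanSubfield hx hr) hwE)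
      exact isMonomial_of_conj_mem hx hmin le_rfl hcK h2 (ne_zero_of_mem h1) (hH _ h1 h2).conj
    refine IsMonomial.normalizes hx hw0
      (isMonomial_of_conj_mem hx hmin (S := commutators G K) ?_ hcM hwE hw0 ?_)
    · rintro _ ⟨a, ha, haK, b, hb, hbK, rfl⟩
      exact cm_mem_of_normalizes (Normalizes.of_mem haK (ne_zero_of_mem ha)) hbK
    · rintro _ ⟨a, ha, haK, b, hb, hbK, rfl⟩
      rw [conj_cm hw0]
      have h0 : ∀ a ∈ elts G, w * a * w⁻¹ ≠ 0 := fun a ha =>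
        mul_ne_zero (mul_ne_zero hw0 (ne_zero_of_mem ha)) (inv_ne_zero hw0)
      exact (hmono a ha haK).cm_mem hx (h0 a ha) (h0 b hb) (hmono b hb hbK)

/-- The inductive step. For a noncentral `K ≠ D` and `x ∈ G` outside `K`, all nonzero elements of
`∑ K x ^ i` normalize `K`, and the Cartan–Brauer–Hua argument applies to them. -/
theorem InvariantTrivial.succ (hn : InvariantTrivial.{u} n) : InvariantTrivial.{u} (n + 1) := by
  intro D _ G hG hGc K hK
  by_contra! hcon
  obtain ⟨hKc, hKtop⟩ := hcon
  replace hKc : ¬ ∀ x ∈ K, x ∈ Subring.center D := by push Not; exact hKc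
  have hC := hn.centralizersCentral
  obtain ⟨H, hH, hGH, hnorm⟩ := id hG
  have hclosure := (hn.centralizer hH hGH hnorm hGc).1
  obtain ⟨x, hxG, hxK⟩ : ∃ x ∈ elts G, x ∉ K := by
    by_contra! h
    refine hKtop (eq_top_iff.2 ?_)
    rw [← hclosure]
    exact Subfield.closure_le.2 h
  have hx := hK x hxG
  have hcK := cent_le_center hC hG hGc hK hKc
  have hcM := cent_commutators hC hG hGc hK hKc
  obtain ⟨a, ha, haK, k, hk, hak⟩ := exists_not_commute hC hG hGc hK hKc
  obtain ⟨r, hr, hmin⟩ := exists_pow_mem_spanLT fun hind =>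
    hak (commute_of_linearIndependent hG hK hx hind ha haK hk)
  have hall := normalizes_of_mem_spanLT hx hr hmin hcK hcM G hG le_rfl fun w hw _ => hK w hw
  have hr1 : 1 < r := by
    by_contra! h
    refine hxK ?_
    have hxE : x ∈ spanLT K x r := self_mem_spanSubfield hx hr
    obtain ⟨c, hc⟩ := mem_spanLT_iff.1 hxE
    rw [← hc]
    refine sum_mem fun i _ => ?_
    rw [show (i : ℕ) = 0 by omega, pow_zero, mul_one]
    exact (c i).2
  have hcent : ∀ b ∈ K, b ≠ 0 → b * x ∈ Subring.center D := by
    intro b hb hb0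
    have hbx : b * x ∉ K := fun h => hxK (by
      simpa [hb0] using mul_mem (inv_mem hb) h)
    have hbxE : b * x ∈ spanLT K x r := by
      have := smul_mem_of_mem hb (pow_mem_spanLT (V := K) (z := x) hr1)
      rwa [pow_one] at this
    have h1 : 1 + b * x ≠ 0 := fun h => hbx (by
      rw [← neg_eq_of_add_eq_zero_right h]
      exact neg_mem (one_mem K))
    refine hcK _ (mem_cent.2 fun s hs => ?_)
    exact (commute_of_normalizes_one_add hbx (hall _ hbxE (mul_ne_zero hb0 hx.ne))
      (hall _ (Submodule.add_mem _ (mem_spanLT_of_mem (one_mem K) (by omega)) hbxE) h1) s hs).symm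
  have hxc : x ∈ cent (Set.univ : Set D) := center_le_cent (by
    simpa using hcent 1 (one_mem K) one_ne_zero)
  refine hKc fun b hb => ?_
  by_cases hb0 : b = 0
  · exact hb0 ▸ zero_mem _
  have hbc : b ∈ cent (Set.univ : Set D) := by
    have := mul_mem (center_le_cent (S := Set.univ) (hcent b hb hb0)) (inv_mem hxc)
    rwa [mul_inv_cancel_right₀ hx.ne] at this
  exact mem_center_iff.2 fun y => mem_cent.1 hbc y trivial

theorem invariantTrivial (n : ℕ) : InvariantTrivial.{u} n := by
  induction n with
  | zero => exact invariantTrivial_zero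
  | succ n ih => exact ih.succ

end Subnormal
/-! ### Almost subnormal subgroups -/

section Index

variable {Γ : Type*} [Group Γ]

/-- Each term of an almost subnormal chain contains a subnormal subgroup with finite index. -/
lemma exists_subnormal {N : ℕ} {S : ℕ → Subgroup Γ} (hN : S N = ⊤)
    (hS : ∀ i < N, S i ≤ S (i + 1) ∧
      ((S i).IsFiniteRelIndex (S (i + 1)) ∨ ((S i).subgroupOf (S (i + 1))).Normal)) {i : ℕ}
    (hi : i ≤ N) : ∃ d, ∃ T ≤ S i, SubnormalOfDepth d T ∧ T.relIndex (S i) ≠ 0 := by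
  induction hi using Nat.decreasingInduction with
  | self => exact ⟨0, S N, le_rfl, hN, by simp⟩
  | of_succ i hi ih =>
    obtain ⟨d, T, hT, hd, hidx⟩ := ih
    obtain ⟨hle, hor⟩ := hS i hi
    have hidx' : T.relIndex (S i) ≠ 0 := mt (Subgroup.relIndex_eq_zero_of_le_right hle) hidx
    rcases hor with hfin | hnorm
    · let C := ((S i).subgroupOf T).normalCore
      have hfin' : (S i).relIndex (S (i + 1)) ≠ 0 := hfin.relIndex_ne_zero
      have : ((S i).subgroupOf T).FiniteIndex :=
        ⟨mt (Subgroup.relIndex_eq_zero_of_le_right hT) hfin'⟩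
      have hCT : C.map T.subtype ≤ T := Subgroup.map_subtype_le C
      have hCS : C.map T.subtype ≤ S i := by
        rintro _ ⟨x, hx, rfl⟩
        exact Subgroup.mem_subgroupOf.1 (Subgroup.normalCore_le _ hx)
      have hC1 : (C.map T.subtype).relIndex T ≠ 0 := by
        have : (C.map T.subtype).subgroupOf T = C :=
          Subgroup.comap_map_eq_self_of_injective T.subtype_injective C
        rw [Subgroup.relIndex, this]
        exact Subgroup.FiniteIndex.index_ne_zero
      refine ⟨d + 1, C.map T.subtype, hCS, ⟨T, hd, hCT, ?_⟩,
        Subgroup.relIndex_ne_zero_trans hC1 hidx'⟩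
      rintro h hh _ ⟨x, hx, rfl⟩
      exact ⟨⟨h, hh⟩ * x * ⟨h, hh⟩⁻¹,
        Subgroup.Normal.conj_mem inferInstance x hx ⟨h, hh⟩, rfl⟩
    · refine ⟨d + 1, S i ⊓ T, inf_le_left, ⟨T, hd, inf_le_right, fun h hh g hg => ⟨?_, ?_⟩⟩,
        by rwa [Subgroup.inf_relIndex_left]⟩
      · exact hnorm.conj_mem ⟨g, hle hg.1⟩ hg.1 ⟨h, hT hh⟩
      · exact T.mul_mem (T.mul_mem hh hg.2) (T.inv_mem hh)

/-- A pigeonhole criterion for finite index. -/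
lemma relIndex_ne_zero_of_finite {H S : Subgroup Γ} {X : Type*} [Finite X] (f : S → X)
    (hf : ∀ s t : S, f s = f t → (s : Γ)⁻¹ * t ∈ H) : H.relIndex S ≠ 0 := by
  have : Finite (S ⧸ H.subgroupOf S) := by
    refine Finite.of_injective (fun q : S ⧸ H.subgroupOf S => f q.out) fun p q hpq => ?_
    rw [← p.out_eq', ← q.out_eq']
    exact QuotientGroup.eq.2 (hf _ _ hpq)
  exact Subgroup.index_ne_zero_of_finite

/-- If `S'` normalizes `S` and `S` is finite modulo the center, then elements `h` of `S` have
finitely many conjugates under `S'`: if `h ^ m` is central, conjugates that agree modulo the center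
differ by an `m`-th root of unity. -/
lemma finite_conj {S S' : Subgroup Γ} (hnorm : ∀ s ∈ S', ∀ g ∈ S, s * g * s⁻¹ ∈ S)
    (hroots : ∀ m > 0, {z : Γ | z ∈ Subgroup.center Γ ∧ z ^ m = 1}.Finite)
    (hS : (Subgroup.center Γ).relIndex S ≠ 0) {h : Γ} (hh : h ∈ S) :
    {c | ∃ s ∈ S', c = s * h * s⁻¹}.Finite := by
  obtain ⟨m, hm, -, hmZ⟩ := Subgroup.exists_pow_mem_of_relIndex_ne_zero hS hh
  have hfin : Finite (S ⧸ (Subgroup.center Γ).subgroupOf S) :=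
    (Subgroup.finiteIndex_iff_finite_quotient).1 ⟨hS⟩
  have hpow : ∀ s : Γ, (s * h * s⁻¹) ^ m = h ^ m := fun s => by
    rw [conj_pow, Subgroup.mem_center_iff.1 hmZ.1 s, mul_inv_cancel_right]
  let C : Set S := {c | ∃ s ∈ S', (c : Γ) = s * h * s⁻¹}
  have hC : C.Finite := by
    refine Set.Finite.of_finite_fibers (fun c : S => (c : S ⧸ (Subgroup.center Γ).subgroupOf S))
      (Set.toFinite _) ?_
    rintro _ ⟨c, ⟨s, hs, hc⟩, rfl⟩
    refine Set.Finite.of_finite_image (f := fun d : S => (c : Γ)⁻¹ * d)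
      ((hroots m hm).subset ?_) fun d _ e _ hde => Subtype.ext (mul_left_cancel hde)
    rintro _ ⟨d, ⟨⟨t, ht, hd⟩, hcd⟩, rfl⟩
    have hz' : c⁻¹ * d ∈ (Subgroup.center Γ).subgroupOf S := QuotientGroup.eq.1 hcd.symm
    have hz : (c : Γ)⁻¹ * d ∈ Subgroup.center Γ := hz'
    refine ⟨hz, ?_⟩
    have hcomm : Commute (c : Γ) ((c : Γ)⁻¹ * d) := Subgroup.mem_center_iff.1 hz c
    have h1 : (d : Γ) ^ m = (c : Γ) ^ m * ((c : Γ)⁻¹ * d) ^ m := by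
      rw [← hcomm.mul_pow, mul_inv_cancel_left]
    rw [hd, hpow, ← hd, hc, hpow, ← hc] at h1
    exact left_eq_mul.1 h1
  refine (hC.image Subtype.val).subset ?_
  rintro _ ⟨s, hs, rfl⟩
  exact ⟨⟨_, hnorm s hs h hh⟩, ⟨s, hs, rfl⟩, rfl⟩

/-- Finiteness modulo the center passes from `S` to a group `S'` normalizing `S`, if the centralizer
of `S` is the center: modulo the center, an element of `S'` is determined by its action on
representatives of `S`, which have finitely many conjugates. -/
lemma relIndex_center_ne_zero {S S' : Subgroup Γ} (hnorm : ∀ s ∈ S', ∀ g ∈ S, s * g * s⁻¹ ∈ S)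
    (hroots : ∀ m > 0, {z : Γ | z ∈ Subgroup.center Γ ∧ z ^ m = 1}.Finite)
    (hS : (Subgroup.center Γ).relIndex S ≠ 0)
    (hcent : ∀ z, (∀ g ∈ S, g * z = z * g) → z ∈ Subgroup.center Γ) :
    (Subgroup.center Γ).relIndex S' ≠ 0 := by
  let Q := S ⧸ (Subgroup.center Γ).subgroupOf S
  have hQ : Finite Q := (Subgroup.finiteIndex_iff_finite_quotient).1 ⟨hS⟩
  have hfin : ∀ q : Q, Finite {c : Γ | ∃ s ∈ S', c = s * (q.out : S) * s⁻¹} := fun q =>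
    (finite_conj hnorm hroots hS q.out.2).to_subtype
  refine relIndex_ne_zero_of_finite
    (X := ∀ q : Q, {c : Γ | ∃ s ∈ S', c = s * (q.out : S) * s⁻¹})
    (fun s q => ⟨s * (q.out : S) * (s : Γ)⁻¹, s, s.2, rfl⟩) fun s t hst => hcent _ fun g hg => ?_
  set y : S := (QuotientGroup.mk (s := (Subgroup.center Γ).subgroupOf S) ⟨g, hg⟩ : Q).out with hy
  have h1 : (s : Γ) * y * (s : Γ)⁻¹ = t * y * (t : Γ)⁻¹ := congrArg Subtype.val (congrFun hst _)
  have h2 : (y : Γ) * ((s : Γ)⁻¹ * t) = (s : Γ)⁻¹ * t * y := by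
    have := congrArg (fun w => (s : Γ)⁻¹ * w * t) h1
    simpa [mul_assoc] using this
  have hz : (y : Γ)⁻¹ * g ∈ Subgroup.center Γ := by
    have h3 : (y : Q) = QuotientGroup.mk ⟨g, hg⟩ := Quotient.out_eq' _
    have h4 : y⁻¹ * ⟨g, hg⟩ ∈ (Subgroup.center Γ).subgroupOf S := QuotientGroup.eq.1 h3
    exact h4
  have hg : g = y * ((y : Γ)⁻¹ * g) := by rw [mul_inv_cancel_left]
  rw [hg, mul_assoc, ← Subgroup.mem_center_iff.1 hz, ← mul_assoc, h2, mul_assoc, mul_assoc]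

end Index

section DivisionRing

universe u

variable {D : Type u} [DivisionRing D]

lemma mem_center_units {u : Dˣ} : u ∈ Subgroup.center Dˣ ↔ (u : D) ∈ Subring.center D := by
  rw [Subgroup.mem_center_iff, mem_center_iff]
  constructor
  · intro h y
    by_cases hy : y = 0
    · simp [hy]
    · exact congrArg Units.val (h (Units.mk0 y hy))
  · exact fun h v => Units.ext (h v)

open Polynomial in
lemma finite_roots_of_unity (m : ℕ) (hm : 0 < m) :
    {z : Dˣ | z ∈ Subgroup.center Dˣ ∧ z ^ m = 1}.Finite := by
  let := centerField D
  have hp : (X ^ m - 1 : (Subring.center D)[X]) ≠ 0 := X_pow_sub_C_ne_zero hm 1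
  refine Set.Finite.of_finite_image (f := (Units.val : Dˣ → D)) ?_ Units.val_injective.injOn
  refine ((finite_setOfPred_isRoot hp).image Subtype.val).subset ?_
  rintro _ ⟨z, ⟨hz, hzm⟩, rfl⟩
  refine ⟨⟨z, mem_center_units.1 hz⟩, ?_, rfl⟩
  have : (z : D) ^ m = 1 := by rw [← Units.val_pow_eq_pow_val, hzm, Units.val_one]
  simp only [Set.mem_ofPred_eq, IsRoot.def, eval_sub, eval_pow, eval_X, eval_one, sub_eq_zero]
  exact Subtype.ext this

/-- A division ring whose multiplicative group is finite modulo its center is commutative. Over an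
infinite center, two of the elements `x + t` with central `t` have central quotient. -/
lemma mem_center_of_index_ne_zero (h : (Subgroup.center Dˣ).index ≠ 0) (x : D) :
    x ∈ Subring.center D := by
  have hQ : Finite (Dˣ ⧸ Subgroup.center Dˣ) := Subgroup.finiteIndex_iff_finite_quotient.1 ⟨h⟩
  rcases finite_or_infinite (Subring.center D) with hfin | hinf
  · have hZ : Finite (Subgroup.center Dˣ) := by
      refine Finite.of_injective (fun u : Subgroup.center Dˣ =>
        (⟨((u : Dˣ) : D), mem_center_units.1 u.2⟩ : Subring.center D)) fun u v huv => ?_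
      exact Subtype.ext (Units.ext (congrArg Subtype.val huv))
    have hU : Finite Dˣ := Nat.finite_of_card_ne_zero (by
      rw [← Subgroup.card_mul_index (Subgroup.center Dˣ)]
      exact mul_ne_zero Nat.card_pos.ne' h)
    have : Finite D := by
      classical
      refine Finite.of_injective (fun y : D => if hy : y = 0 then none else some (Units.mk0 y hy))
        fun y z hyz => ?_
      by_cases hy : y = 0 <;> by_cases hz : z = 0 <;> simp_all
    exact mem_center_iff.2 fun y => (Finite.isDomain_to_isField D).mul_comm y x
  · by_contra hx
    have hne : ∀ t : Subring.center D, x + t ≠ 0 := fun t ht => hx (by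
      rw [eq_neg_of_add_eq_zero_left ht]
      exact neg_mem t.2)
    obtain ⟨s, t, hst, he⟩ := Finite.exists_ne_map_eq_of_infinite
      fun t : Subring.center D => (Units.mk0 (x + t) (hne t) : Dˣ ⧸ Subgroup.center Dˣ)
    have hz := mem_center_units.1 (QuotientGroup.eq.1 he)
    set z := (Units.mk0 (x + s) (hne s))⁻¹ * Units.mk0 (x + t) (hne t) with hzdef
    have h1 : (x + s) * (z : D) = x + t := by
      have : Units.mk0 (x + s) (hne s) * z = Units.mk0 (x + t) (hne t) := by
        rw [hzdef, mul_inv_cancel_left]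
      exact congrArg Units.val this
    have hxz : x * (1 - (z : D)) = s * z - t := by
      linear_combination (norm := noncomm_ring) -h1
    have hz1 : 1 - (z : D) ≠ 0 := fun h0 => hst (by
      rw [h0, mul_zero, ← sub_eq_zero.1 h0, mul_one] at hxz
      exact Subtype.ext (sub_eq_zero.1 hxz.symm))
    have hxe : x = (s * z - t) * (1 - (z : D))⁻¹ := by rw [← hxz, mul_inv_cancel_right₀ hz1]
    have hmem : ∀ y ∈ Subring.center D, y ∈ cent (Set.univ : Set D) := fun y hy => center_le_cent hy
    have hxc : x ∈ cent (Set.univ : Set D) := by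
      rw [hxe]
      exact mul_mem (sub_mem (mul_mem (hmem _ s.2) (hmem _ hz)) (hmem _ t.2))
        (inv_mem (sub_mem (one_mem _) (hmem _ hz)))
    exact hx (mem_center_iff.2 fun y => mem_cent.1 hxc y trivial)

variable {K : Subfield D}

lemma relIndex_center_of_central {S T : Subgroup Dˣ} (hT : ∀ g ∈ elts T, g ∈ Subring.center D)
    (h : T.relIndex S ≠ 0) : (Subgroup.center Dˣ).relIndex S ≠ 0 := by
  refine mt (Subgroup.relIndex_eq_zero_of_le_left fun u hu => ?_) h
  exact mem_center_units.2 (hT u ⟨u, hu, rfl⟩)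

/-- The reduction of the almost subnormal case to the subnormal one. -/
theorem invariant_trivial_of_isAlmostSubnormal {G : Subgroup Dˣ} (hG : IsAlmostSubnormal G)
    (hGc : ¬ ∀ g ∈ elts G, g ∈ Subring.center D) (hK : Invariant G K) :
    (∀ x ∈ K, x ∈ Subring.center D) ∨ K = ⊤ := by
  obtain ⟨N, S, rfl, hN, hS⟩ := hG
  obtain ⟨d, T, hTS, hd, hT⟩ := exists_subnormal hN hS (Nat.zero_le N)
  by_cases hTc : ∀ g ∈ elts T, g ∈ Subring.center D
  swap
  · exact invariantTrivial d D T hd hTc K fun g hg => hK g (elts_mono hTS hg)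
  -- otherwise finiteness modulo the center climbs the whole chain
  exfalso
  have hle : ∀ i ≤ N, S 0 ≤ S i := fun i => by
    induction i with
    | zero => exact fun _ => le_rfl
    | succ i ih => exact fun hi => (ih (by omega)).trans (hS i (by omega)).1
  have hΦ : ∀ i ≤ N, (Subgroup.center Dˣ).relIndex (S i) ≠ 0 := fun i => by
    induction i with
    | zero => exact fun _ => relIndex_center_of_central hTc hT
    | succ i ih =>
      intro hi
      have hSi := ih (by omega)
      obtain ⟨hSS, hfin | hnorm⟩ := hS i (by omega)
      · exact Subgroup.relIndex_ne_zero_trans hSi hfin.relIndex_ne_zero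
      obtain ⟨e, T', hT'S, he, hT'⟩ := exists_subnormal hN hS hi
      by_cases hT'c : ∀ g ∈ elts T', g ∈ Subring.center D
      · exact relIndex_center_of_central hT'c hT'
      have hconj : ∀ s ∈ S (i + 1), ∀ g ∈ S i, s * g * s⁻¹ ∈ S i := fun s hs g hg =>
        hnorm.conj_mem ⟨g, hSS hg⟩ hg ⟨s, hs⟩
      have hinv : Invariant T' (cent (elts (S i))) := fun g hg =>
        Normalizes.cent (ne_zero_of_mem hg)
          (fun s hs => conj_mem_elts hconj (elts_mono hT'S hg) hs)
          (fun s hs => by simpa using conj_mem_elts hconj (inv_mem_elts (elts_mono hT'S hg)) hs)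
      refine relIndex_center_ne_zero hconj finite_roots_of_unity hSi fun z hz => ?_
      rcases invariantTrivial e D T' he hT'c _ hinv with h | h
      · refine mem_center_units.2 (h z (mem_cent.2 ?_))
        rintro _ ⟨u, hu, rfl⟩
        exact congrArg Units.val (hz u hu)
      · refine absurd (fun g hg => mem_center_iff.2 fun y => ?_) hGc
        exact (mem_cent.1 (h ▸ trivial : y ∈ cent (elts (S i))) g
          (elts_mono (hle i (by omega)) hg)).symm
  have := hΦ N le_rfl
  rw [hN, Subgroup.relIndex_top_right] at this
  exact hGc fun g _ => mem_center_of_index_ne_zero this g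

end DivisionRing
end AlmostSubnormal

theorem mainTheorem5 {D : Type*} [DivisionRing D] (K : Subfield D) (G : Subgroup Dˣ)
    (hG : IsAlmostSubnormal G)
    (hGF : ¬ ∀ g ∈ G, (g : D) ∈ Subring.center D)
    (hK : ∀ g ∈ G, ∀ x ∈ K, (↑g⁻¹ : D) * x * (g : D) ∈ K) :
    (∀ x ∈ K, x ∈ Subring.center D) ∨ K = ⊤ := by
  refine AlmostSubnormal.invariant_trivial_of_isAlmostSubnormal hG
    (fun h => hGF fun g hg => h g ⟨g, hg, rfl⟩) (AlmostSubnormal.invariant_of_conj ?_)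
  rintro _ ⟨g, hg, rfl⟩ x hx
  simpa using hK g⁻¹ (inv_mem hg) x hx
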